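/- Let $1 \le k < d$, let $X$ be a random vector in $\mathbb{R}^d$ with $\mathbb{E}\|X\|_2^2 < \infty$, and let $X_1, X_2, \dots$ be i.i.d. copies of $X$. Let $\Sigma = \mathbb{E}[XX^T]$, let $(u_j)_{j=1}^d$ be an orthonormal basis of eigenvectors of $\Sigma$ ordered non-increasingly according to their eigenvalues $(\lambda_j)_{j=1}^d$, and let $U_*$ be the $d \times k$ matrix with columns $u_1, \dots, u_k$. For each $n$ let $\Sigma_n = n^{-1}\sum_{i=1}^n X_iX_i^T$ and let $U_n$ be the $d\times k$ matrix whose columns are the first $k$ vectors of an orthonormal basis of eigenvectors of $\Sigma_n$, ordered non-increasingly according to their eigenvalues, with ties broken arbitrarily. For a $d \times k$ matrix $U$ with orthonormal columns put $R(U) = \frac12 \mathbb{E}\|X - UU^TX\|_2^2$, where the expectation is over $X$ only, and let $\mathcal{E}_n = R(U_n) - R(U_*)$ be the excess risk of PCA. For a real random variable $Z$ and $p \in [0,1]$ let $Q_Z(p) = \inf\{t \in \mathbb{R} \mid \mathbb{P}(Z \le t) \ge p\}$. Assume that $\lambda_k > \lambda_{k+1}$ and that for all $i, s \in \{1,\dots,d-k\}$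 and $j, t \in \{1,\dots,k\}$ the expectation $$\Lambda_{ijst} = \mathbb{E}\big[\langle u_{k+i},X\rangle\langle u_j,X\rangle\langle u_{k+s},X\rangle\langle u_t,X\rangle\big]$$ is finite (the product is integrable). Put $\delta_{ij} = \lambda_j - \lambda_{k+i}$, let $H$ be a mean zero $(d-k)\times k$ Gaussian matrix with $\mathbb{E}[H_{ij}H_{st}] = \Lambda_{ijst}/\sqrt{\delta_{ij}\delta_{st}}$, and let $\tau^2 = \sup_{\|A\|_F = 1} \mathbb{E}[\langle A, H\rangle_F^2]$ (the largest eigenvalue of the covariance of $H$). For $\delta \in [0, 0.1)$ put $$B(\delta) = \sum_{i=1}^{d-k}\sum_{j=1}^{k} \frac{\mathbb{E}\big[\langle u_{k+i},X\rangle^2\langle u_j,X\rangle^2\big]}{\lambda_j - \lambda_{k+i}} + 2\tau^2\log(1/\delta),$$ with $\log(1/0) = +\infty$. Then for every $\delta \in [0,0.1)$, where in the case $\delta = 0$ it is also assumed that $\tau^2 > 0$, the limit $\lim_{n\to\infty} n \cdot Q_{\mathcal{E}_n}(1-\delta)$ exists in $[0, +\infty]$ and $$\frac{1}{64}\, B(\delta)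 \;\le\; \lim_{n\to\infty} n \cdot Q_{\mathcal{E}_n}(1-\delta) \;\le\; B(\delta).$$ -/

import Mathlib

open MeasureTheory ProbabilityTheory Filter Topology Matrix
open scoped RealInnerProductSpace

noncomputable section

namespace PCA

/-- The index `j ∈ {1, …, k}` of one of the top `k` eigenvectors, seen in `{1, …, d}`. -/
def topIdx {d k : ℕ} (hk : k < d) (j : Fin k) : Fin d := ⟨j, j.isLt.trans hk⟩

/-- The index `k + i`, with `i ∈ {1, …, d - k}`, of one of the bottom `d - k` eigenvectors. -/
def botIdx {d k : ℕ} (i : Fin (d - k)) : Fin d := ⟨k + i, by have := i.isLt; omega⟩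

/-- The population covariance matrix `Σ = E[X Xᵀ]`, entry by entry. -/
def covMatrix {d : ℕ} {Ω : Type*} [MeasurableSpace Ω] (P : Measure Ω)
    (X : Ω → EuclideanSpace ℝ (Fin d)) : Matrix (Fin d) (Fin d) ℝ :=
  Matrix.of fun a b => ∫ ω, X ω a * X ω b ∂P

/-- The empirical covariance matrix `Σₙ = n⁻¹ ∑ᵢ xᵢ xᵢᵀ` of the first `n` points of a sequence. -/
def empCovMatrix {d : ℕ} (x : ℕ → EuclideanSpace ℝ (Fin d)) (n : ℕ) :
    Matrix (Fin d) (Fin d) ℝ :=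
  (n : ℝ)⁻¹ • ∑ i ∈ Finset.range n, Matrix.vecMulVec (x i).ofLp (x i).ofLp

/-- `u` is an orthonormal basis of eigenvectors of `M`, with eigenvalues `lam` in non-increasing
order. Ties may be broken in any way. -/
def IsOrderedEigenbasis {d : ℕ} (M : Matrix (Fin d) (Fin d) ℝ)
    (u : OrthonormalBasis (Fin d) ℝ (EuclideanSpace ℝ (Fin d))) (lam : Fin d → ℝ) : Prop :=
  Antitone lam ∧ ∀ j, M *ᵥ (u j).ofLp = lam j • (u j).ofLp

/-- The `d × k` matrix whose `j`-th column is the `j`-th vector of the basis. -/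
def topFrame {d k : ℕ} (hk : k < d)
    (u : OrthonormalBasis (Fin d) ℝ (EuclideanSpace ℝ (Fin d))) : Matrix (Fin d) (Fin k) ℝ :=
  Matrix.of fun a j => u (topIdx hk j) a

/-- The population reconstruction risk `R([U]) = (1/2) E‖X - U Uᵀ X‖²`. -/
def risk {d k : ℕ} {Ω : Type*} [MeasurableSpace Ω] (P : Measure Ω)
    (X : Ω → EuclideanSpace ℝ (Fin d)) (U : Matrix (Fin d) (Fin k) ℝ) : ℝ :=
  (1 / 2) * ∫ ω, ‖X ω - WithLp.toLp 2 ((U * Uᵀ) *ᵥ (X ω).ofLp)‖ ^ 2 ∂P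

/-- The `p`-quantile `inf {t ∈ ℝ | P(Z ≤ t) ≥ p}` of a real random variable; the infimum is taken
in the extended reals, so that it is `+∞` when no real `t` qualifies. -/
def quantile {Ω : Type*} [MeasurableSpace Ω] (P : Measure Ω) (Z : Ω → ℝ) (p : ℝ) : EReal :=
  sInf {q : EReal | ∃ t : ℝ, p ≤ P.real {ω | Z ω ≤ t} ∧ q = (t : EReal)}

/-- `Λ_{ijst} = E[⟨u_{k+i}, X⟩ ⟨u_j, X⟩ ⟨u_{k+s}, X⟩ ⟨u_t, X⟩]`. -/
def fourthMoment {d k : ℕ} (hk : k < d) {Ω : Type*} [MeasurableSpace Ω] (P : Measure Ω)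
    (X : Ω → EuclideanSpace ℝ (Fin d))
    (u : OrthonormalBasis (Fin d) ℝ (EuclideanSpace ℝ (Fin d)))
    (i : Fin (d - k)) (j : Fin k) (s : Fin (d - k)) (t : Fin k) : ℝ :=
  ∫ ω, ⟪u (botIdx i), X ω⟫ * ⟪u (topIdx hk j), X ω⟫ *
    ⟪u (botIdx s), X ω⟫ * ⟪u (topIdx hk t), X ω⟫ ∂P

/-- The gap `λ_j - λ_{k+i}`. -/
def gap {d k : ℕ} (hk : k < d) (lam : Fin d → ℝ) (i : Fin (d - k)) (j : Fin k) : ℝ :=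
  lam (topIdx hk j) - lam (botIdx i)

/-- The covariance `E[H_{ij} H_{st}] = Λ_{ijst} / √(δ_{ij} δ_{st})` of the entries of `H`, where
`δ_{ij} = λ_j - λ_{k+i}`. -/
def covH {d k : ℕ} (hk : k < d) {Ω : Type*} [MeasurableSpace Ω] (P : Measure Ω)
    (X : Ω → EuclideanSpace ℝ (Fin d))
    (u : OrthonormalBasis (Fin d) ℝ (EuclideanSpace ℝ (Fin d))) (lam : Fin d → ℝ) :
    Matrix (Fin (d - k) × Fin k) (Fin (d - k) × Fin k) ℝ :=
  Matrix.of fun a b => fourthMoment hk P X u a.1 a.2 b.1 b.2 /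
    √(gap hk lam a.1 a.2 * gap hk lam b.1 b.2)

/-- The law of the mean zero `(d - k) × k` Gaussian matrix `H`. Matrices are vectors indexed by
pairs `(i, j)`, so that the Euclidean inner product is the Frobenius one. -/
def lawH {d k : ℕ} (hk : k < d) {Ω : Type*} [MeasurableSpace Ω] (P : Measure Ω)
    (X : Ω → EuclideanSpace ℝ (Fin d))
    (u : OrthonormalBasis (Fin d) ℝ (EuclideanSpace ℝ (Fin d))) (lam : Fin d → ℝ) :
    Measure (EuclideanSpace ℝ (Fin (d - k) × Fin k)) :=
  multivariateGaussian 0 (covH hk P X u lam)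

/-- `τ² = sup_{‖A‖_F = 1} E[⟨A, H⟩_F²]`. -/
def tauSq {d k : ℕ} (hk : k < d) {Ω : Type*} [MeasurableSpace Ω] (P : Measure Ω)
    (X : Ω → EuclideanSpace ℝ (Fin d))
    (u : OrthonormalBasis (Fin d) ℝ (EuclideanSpace ℝ (Fin d))) (lam : Fin d → ℝ) : ℝ :=
  sSup {r : ℝ | ∃ A : EuclideanSpace ℝ (Fin (d - k) × Fin k), ‖A‖ = 1 ∧
    r = ∫ h, ⟪A, h⟫ ^ 2 ∂(lawH hk P X u lam)}

/-- `∑_{i,j} E[⟨u_{k+i}, X⟩² ⟨u_j, X⟩²] / (λ_j - λ_{k+i})`. -/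
def traceTerm {d k : ℕ} (hk : k < d) {Ω : Type*} [MeasurableSpace Ω] (P : Measure Ω)
    (X : Ω → EuclideanSpace ℝ (Fin d))
    (u : OrthonormalBasis (Fin d) ℝ (EuclideanSpace ℝ (Fin d))) (lam : Fin d → ℝ) : ℝ :=
  ∑ i : Fin (d - k), ∑ j : Fin k,
    (∫ ω, ⟪u (botIdx i), X ω⟫ ^ 2 * ⟪u (topIdx hk j), X ω⟫ ^ 2 ∂P) /
      (lam (topIdx hk j) - lam (botIdx i))

/-- `log (1 / δ)` for `δ ≥ 0`, with the value `+∞` at `δ = 0`. -/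
def logInv (δ : ℝ) : EReal := ENNReal.log (ENNReal.ofReal δ)⁻¹

/-- The matrix `covH` is a genuine covariance matrix, so `lawH` is the Gaussian law with that
covariance. -/
theorem covH_posSemidef {d k : ℕ} (hk : k < d) {Ω : Type*} [MeasurableSpace Ω] (P : Measure Ω)
    (X : Ω → EuclideanSpace ℝ (Fin d))
    (u : OrthonormalBasis (Fin d) ℝ (EuclideanSpace ℝ (Fin d))) (lam : Fin d → ℝ)
    (hgap : ∀ i j, 0 < gap (k := k) hk lam i j)
    (hint : ∀ (i s : Fin (d - k)) (j t : Fin k), Integrable (fun ω =>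
      ⟪u (botIdx i), X ω⟫ * ⟪u (topIdx hk j), X ω⟫ *
        ⟪u (botIdx s), X ω⟫ * ⟪u (topIdx hk t), X ω⟫) P) :
    (covH (k := k) hk P X u lam).PosSemidef := by
  refine Matrix.PosSemidef.of_dotProduct_mulVec_nonneg ?_ fun x => ?_
  · ext a b
    simp only [covH, fourthMoment, Matrix.conjTranspose_apply, Matrix.of_apply, star_trivial]
    rw [mul_comm (gap hk lam b.1 b.2)]
    congr 1
    refine integral_congr_ae (.of_forall fun ω => ?_)
    simp only
    ring
  · have key : star x ⬝ᵥ (covH (k := k) hk P X u lam *ᵥ x) = ∫ ω, (∑ a, x a *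
        (⟪u (botIdx a.1), X ω⟫ * ⟪u (topIdx hk a.2), X ω⟫ / √(gap hk lam a.1 a.2))) ^ 2 ∂P := by
      have hsq : ∀ ω, (∑ a, x a * (⟪u (botIdx a.1), X ω⟫ * ⟪u (topIdx hk a.2), X ω⟫ /
            √(gap hk lam a.1 a.2))) ^ 2 = ∑ a, ∑ b, (x a * x b /
            √(gap hk lam a.1 a.2 * gap hk lam b.1 b.2)) *
            (⟪u (botIdx a.1), X ω⟫ * ⟪u (topIdx hk a.2), X ω⟫ *
              ⟪u (botIdx b.1), X ω⟫ * ⟪u (topIdx hk b.2), X ω⟫) := by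
        intro ω
        rw [sq, Finset.sum_mul_sum]
        refine Finset.sum_congr rfl fun a _ => Finset.sum_congr rfl fun b _ => ?_
        rw [Real.sqrt_mul (hgap _ _).le]
        have h1 := (Real.sqrt_pos.2 (hgap a.1 a.2)).ne'
        have h2 := (Real.sqrt_pos.2 (hgap b.1 b.2)).ne'
        field_simp
      simp_rw [hsq]
      rw [integral_finsetSum _ fun a _ => integrable_finsetSum _ fun b _ =>
        (hint _ _ _ _).const_mul _]
      simp only [dotProduct, mulVec, star_trivial, Finset.mul_sum]
      refine Finset.sum_congr rfl fun a _ => ?_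
      rw [integral_finsetSum _ fun b _ => (hint _ _ _ _).const_mul _]
      refine Finset.sum_congr rfl fun b _ => ?_
      rw [integral_const_mul]
      simp only [covH, fourthMoment, Matrix.of_apply]
      ring
    rw [key]
    exact integral_nonneg fun ω => sq_nonneg _

end PCA

end

/-! In the eigenbasis of `Σ` the covariance is diagonal, and twice the excess risk depends only on
the projector `N = Uₙ Uₙᵀ`. Since `N` commutes with `M = Σₙ`, its off-diagonal block `F` solves a
Sylvester equation, `(λ_j - λ_{k+i}) F_ij ≈ M_ij` up to second order terms, while the diagonal
blocks of `N` and `1 - N` are quadratic in `F`. So twice the excess risk is close to `∑ (λ_j -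
λ_{k+i}) F_ij²`, hence to `∑ M_ij² / (λ_j - λ_{k+i})`.

The approximation (`exists_abs_projExcess_sub_leadingTerm_le`) is deterministic and its error is a
small multiple of the leading term itself. It therefore needs no rate for `Σₙ → Σ`: the law of large
numbers suffices, and no fourth moments beyond the `Λ_{ijst}` enter. Multiplied by `n`, the leading
term is the squared norm of a normalized sum of centred i.i.d. vectors with covariance `covH`, so
the central limit theorem makes `n 𝓔ₙ` behave like `‖H‖² / 2`.

Quantiles pass to the limit because the distribution function of `‖H‖² / 2` is strictly increasing
where it matters (`lt_measureReal_of_le_measureReal`). With ties broken arbitrarily, `Uₙ` need not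
be measurable, so events involving it are compared only through inclusions.

Finally `‖H‖²` is a weighted sum of squares of independent standard Gaussians, the weights being the
eigenvalues of `covH`. A Chernoff bound gives the upper estimate. For the lower one, a Paley–Zygmund
argument controls the trace, and the coordinate of largest variance controls `τ² log (1/δ)`. -/

namespace PCA

/-! ### Deterministic perturbation of spectral projectors -/

section Perturbation

variable {m : Type*} [Fintype m]

lemma proj_diag_eq_sum_sq {N : Matrix m m ℝ} (hs : N.IsSymm) (hi : N * N = N) (x : m) :
    N x x = ∑ y, N x y ^ 2 := by
  conv_lhs => rw [← hi, Matrix.mul_apply]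
  exact Finset.sum_congr rfl fun y _ => by rw [sq, hs.apply]

lemma proj_diag_nonneg {N : Matrix m m ℝ} (hs : N.IsSymm) (hi : N * N = N) (x : m) :
    0 ≤ N x x := by
  rw [proj_diag_eq_sum_sq hs hi]
  positivity

/-- Cauchy–Schwarz for two rows, because `N = N Nᵀ` is the Gram matrix of its own rows. -/
lemma proj_sq_le_mul {N : Matrix m m ℝ} (hs : N.IsSymm) (hi : N * N = N) (x y : m) :
    N x y ^ 2 ≤ N x x * N y y := by
  rw [proj_diag_eq_sum_sq hs hi x, proj_diag_eq_sum_sq hs hi y]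
  have : N x y = ∑ z, N x z * N y z := by
    conv_lhs => rw [← hi, Matrix.mul_apply]
    exact Finset.sum_congr rfl fun z _ => by rw [hs.apply z y]
  rw [this]
  exact Finset.sum_mul_sq_le_sq_mul_sq _ _ _

variable [DecidableEq m]

lemma proj_compl {N : Matrix m m ℝ} (hs : N.IsSymm) (hi : N * N = N) :
    (1 - N).IsSymm ∧ (1 - N) * (1 - N) = 1 - N :=
  ⟨Matrix.isSymm_one.sub hs, by simp [mul_sub, sub_mul, hi]⟩

lemma proj_diag_le_one {N : Matrix m m ℝ} (hs : N.IsSymm) (hi : N * N = N) (x : m) :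
    N x x ≤ 1 := by
  have := proj_diag_nonneg (proj_compl hs hi).1 (proj_compl hs hi).2 x
  simpa using this

lemma proj_abs_le_one {N : Matrix m m ℝ} (hs : N.IsSymm) (hi : N * N = N) (x y : m) :
    |N x y| ≤ 1 := by
  rw [← sq_le_one_iff_abs_le_one]
  exact (proj_sq_le_mul hs hi x y).trans
    (mul_le_one₀ (proj_diag_le_one hs hi x) (proj_diag_nonneg hs hi y) (proj_diag_le_one hs hi y))

variable {ι κ : Type*} [Fintype ι] [Fintype κ]

/-- Twice the excess risk of the orthogonal projector `N`, written in the eigenbasis of the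
population covariance. -/
def projExcess (l : ι → ℝ) (m : κ → ℝ) (N : Matrix (ι ⊕ κ) (ι ⊕ κ) ℝ) : ℝ :=
  ∑ a, l a * (1 - N (.inl a) (.inl a)) - ∑ i, m i * N (.inr i) (.inr i)

/-- The leading term of `projExcess` at the top projector of `M`. -/
noncomputable def leadingTerm (l : ι → ℝ) (m : κ → ℝ) (M : Matrix (ι ⊕ κ) (ι ⊕ κ) ℝ) : ℝ :=
  ∑ i, ∑ a, M (.inr i) (.inl a) ^ 2 / (l a - m i)

variable {l : ι → ℝ} {m : κ → ℝ} {M N : Matrix (ι ⊕ κ) (ι ⊕ κ) ℝ}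

lemma sum_bot_eq (htr : N.trace = Fintype.card ι) :
    ∑ i, N (.inr i) (.inr i) = ∑ a, (1 - N (.inl a) (.inl a)) := by
  simp only [Matrix.trace, Fintype.sum_sum_type, Matrix.diag_apply] at htr
  simp [← htr]

lemma diag_inr_eq (hs : N.IsSymm) (hi : N * N = N) (i : κ) :
    N (.inr i) (.inr i) = ∑ a, N (.inr i) (.inl a) ^ 2 + ∑ j, N (.inr i) (.inr j) ^ 2 := by
  rw [proj_diag_eq_sum_sq hs hi, Fintype.sum_sum_type]

lemma sum_sq_bot_le (hs : N.IsSymm) (hi : N * N = N) :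
    ∑ i, ∑ j, N (.inr i) (.inr j) ^ 2 ≤ (∑ i : κ, N (.inr i) (.inr i)) ^ 2 := by
  rw [sq, Finset.sum_mul_sum]
  exact Finset.sum_le_sum fun a _ => Finset.sum_le_sum fun b _ => proj_sq_le_mul hs hi _ _

lemma gap_mul_sum_sq_le {g : ℝ} (hδ : ∀ i a, g ≤ l a - m i) :
    g * ∑ i, ∑ a, N (.inr i) (.inl a) ^ 2 ≤ ∑ i, ∑ a, (l a - m i) * N (.inr i) (.inl a) ^ 2 := by
  rw [Finset.mul_sum]
  refine Finset.sum_le_sum fun i _ => ?_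
  rw [Finset.mul_sum]
  exact Finset.sum_le_sum fun a _ => mul_le_mul_of_nonneg_right (hδ i a) (sq_nonneg _)

lemma leadingTerm_nonneg {g : ℝ} (hg : 0 < g) (hδ : ∀ i a, g ≤ l a - m i) :
    0 ≤ leadingTerm l m M :=
  Finset.sum_nonneg fun i _ => Finset.sum_nonneg fun a _ =>
    div_nonneg (sq_nonneg _) (hg.le.trans (hδ i a))

lemma sum_sq_le_leadingTerm {g L : ℝ} (hg : 0 < g) (hδ : ∀ i a, g ≤ l a - m i)
    (hδL : ∀ i a, l a - m i ≤ 2 * L) :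
    ∑ i, ∑ a, M (.inr i) (.inl a) ^ 2 ≤ 2 * L * leadingTerm l m M := by
  rw [leadingTerm, Finset.mul_sum]
  refine Finset.sum_le_sum fun i _ => ?_
  rw [Finset.mul_sum]
  refine Finset.sum_le_sum fun a _ => ?_
  have := hg.trans_le (hδ i a)
  rw [← mul_div_assoc, le_div_iff₀ this, mul_comm (2 * L)]
  exact mul_le_mul_of_nonneg_left (hδL i a) (sq_nonneg _)

variable [DecidableEq ι] [DecidableEq κ]

/-- A priori consistency. With `Λ = diagonal (Sum.elim l m)` and `T` the projector on the first
block, the excess is `tr (Λ (T - N))`, while `hKF` says `tr (M (T - N)) ≤ 0`. Only `tr ((Λ - M) (T -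
N))` is left, with entries at most `r` and `2`. -/
lemma projExcess_le_of_close {r : ℝ} (hs : N.IsSymm) (hi : N * N = N)
    (hKF : ∑ a, M (.inl a) (.inl a) ≤ (M * N).trace)
    (hM : ∀ x y, |M x y - diagonal (Sum.elim l m) x y| ≤ r) :
    projExcess l m N ≤ 2 * (Fintype.card (ι ⊕ κ) : ℝ) ^ 2 * r := by
  set T : Matrix (ι ⊕ κ) (ι ⊕ κ) ℝ := diagonal (Sum.elim 1 0) with hT
  have h1 : projExcess l m N = (diagonal (Sum.elim l m) * (T - N)).trace := by
    simp [projExcess, Matrix.trace, T, diagonal_mul, Fintype.sum_sum_type, sub_eq_add_neg]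
  have h2 : (M * (T - N)).trace ≤ 0 := by
    rw [mul_sub, trace_sub, sub_nonpos]
    simpa [T, Matrix.trace, mul_diagonal, Fintype.sum_sum_type] using hKF
  have h3 : ((diagonal (Sum.elim l m) - M) * (T - N)).trace ≤
      ∑ _x : ι ⊕ κ, ∑ _y : ι ⊕ κ, r * 2 := by
    rw [Matrix.trace]
    refine Finset.sum_le_sum fun x _ => ?_
    rw [Matrix.diag_apply, Matrix.mul_apply]
    refine Finset.sum_le_sum fun y _ => ?_
    refine (le_abs_self _).trans ?_
    rw [abs_mul]
    have hT1 : |T y x| ≤ 1 := by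
      rw [hT, Matrix.diagonal_apply]
      split_ifs
      · rcases y with y | y <;> simp
      · simp
    have := proj_abs_le_one hs hi y x
    refine mul_le_mul ?_ ?_ (abs_nonneg _) ((abs_nonneg _).trans (hM x y))
    · rw [Matrix.sub_apply, abs_sub_comm]; exact hM x y
    · rw [Matrix.sub_apply]
      exact (abs_sub _ _).trans (by linarith)
  rw [sub_mul, trace_sub] at h3
  simp only [Finset.sum_const, Finset.card_univ, nsmul_eq_mul] at h3
  rw [h1]
  nlinarith

/-- The mass lost by `N` on the top block equals the mass gained on the bottom block, by the trace
condition. Moving that mass across the gap costs at least `g` per unit. -/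
lemma gap_mul_le_projExcess {c g : ℝ} (hs : N.IsSymm) (hi : N * N = N)
    (htr : N.trace = Fintype.card ι) (hl : ∀ a, c + g ≤ l a) (hm : ∀ i, m i ≤ c) :
    g * ∑ a, (1 - N (.inl a) (.inl a)) ≤ projExcess l m N := by
  have htr' := sum_bot_eq htr
  have h1 : ∑ a, (c + g) * (1 - N (.inl a) (.inl a)) ≤ ∑ a, l a * (1 - N (.inl a) (.inl a)) :=
    Finset.sum_le_sum fun a _ => mul_le_mul_of_nonneg_right (hl a)
      (sub_nonneg.2 (proj_diag_le_one hs hi _))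
  have h2 : ∑ i, m i * N (.inr i) (.inr i) ≤ ∑ i, c * N (.inr i) (.inr i) :=
    Finset.sum_le_sum fun i _ => mul_le_mul_of_nonneg_right (hm i) (proj_diag_nonneg hs hi _)
  rw [← Finset.mul_sum] at h1 h2
  rw [projExcess]
  rw [htr'] at h2
  linarith

lemma one_sub_diag_eq (hs : N.IsSymm) (hi : N * N = N) (a : ι) :
    1 - N (.inl a) (.inl a) = ∑ b, (1 - N) (.inl a) (.inl b) ^ 2 +
      ∑ i, N (.inr i) (.inl a) ^ 2 := by
  have := proj_diag_eq_sum_sq (proj_compl hs hi).1 (proj_compl hs hi).2 (.inl a)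
  rw [Fintype.sum_sum_type] at this
  simp only [Matrix.sub_apply, Matrix.one_apply_eq] at this ⊢
  rw [this]
  congr 1
  exact Finset.sum_congr rfl fun i _ => by simp [hs.apply (.inl a) (.inr i)]

lemma sum_sq_top_le (hs : N.IsSymm) (hi : N * N = N) :
    ∑ a, ∑ b, (1 - N) (.inl a) (.inl b) ^ 2 ≤ (∑ a, (1 - N (.inl a) (.inl a))) ^ 2 := by
  rw [sq, Finset.sum_mul_sum]
  refine Finset.sum_le_sum fun a _ => Finset.sum_le_sum fun b _ => ?_
  simpa using proj_sq_le_mul (proj_compl hs hi).1 (proj_compl hs hi).2 (.inl a) (.inl b)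

/-- Each diagonal entry of `N` and of `1 - N` is the sum of squares of its row. The off-diagonal
block produces exactly the weighted sum; the two diagonal blocks have squared Frobenius norm at most
the square of the displaced mass. -/
lemma abs_projExcess_sub_le {L : ℝ} (hs : N.IsSymm) (hi : N * N = N)
    (htr : N.trace = Fintype.card ι) (hl : ∀ a, |l a| ≤ L) (hm : ∀ i, |m i| ≤ L) (hL : 0 ≤ L) :
    |projExcess l m N - ∑ i, ∑ a, (l a - m i) * N (.inr i) (.inl a) ^ 2| ≤
      2 * L * (∑ a, (1 - N (.inl a) (.inl a))) ^ 2 := by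
  have h1 : projExcess l m N - ∑ i, ∑ a, (l a - m i) * N (.inr i) (.inl a) ^ 2 =
      ∑ a, l a * ∑ b, (1 - N) (.inl a) (.inl b) ^ 2 -
        ∑ i, m i * ∑ j, N (.inr i) (.inr j) ^ 2 := by
    rw [projExcess]
    simp_rw [one_sub_diag_eq hs hi]
    conv_lhs => enter [1, 2, 2, i]; rw [diag_inr_eq hs hi]
    simp_rw [mul_add, Finset.sum_add_distrib, sub_mul, Finset.sum_sub_distrib, Finset.mul_sum]
    rw [Finset.sum_comm (f := fun a i => l a * N (Sum.inr i) (Sum.inl a) ^ 2)]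
    ring
  rw [h1]
  have h2 : |∑ a, l a * ∑ b, (1 - N) (.inl a) (.inl b) ^ 2| ≤
      L * (∑ a, (1 - N (.inl a) (.inl a))) ^ 2 := by
    refine (Finset.abs_sum_le_sum_abs _ _).trans ?_
    refine (Finset.sum_le_sum fun a _ => ?_).trans
      ((Finset.mul_sum _ _ _).symm.le.trans (mul_le_mul_of_nonneg_left (sum_sq_top_le hs hi) hL))
    rw [abs_mul, abs_of_nonneg (a := ∑ b, _) (Finset.sum_nonneg fun b _ => sq_nonneg _)]
    exact mul_le_mul_of_nonneg_right (hl a) (Finset.sum_nonneg fun b _ => sq_nonneg _)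
  have h3 : |∑ i, m i * ∑ j, N (.inr i) (.inr j) ^ 2| ≤
      L * (∑ a, (1 - N (.inl a) (.inl a))) ^ 2 := by
    rw [← sum_bot_eq htr]
    refine (Finset.abs_sum_le_sum_abs _ _).trans ?_
    refine (Finset.sum_le_sum fun a _ => ?_).trans
      ((Finset.mul_sum _ _ _).symm.le.trans (mul_le_mul_of_nonneg_left (sum_sq_bot_le hs hi) hL))
    rw [abs_mul, abs_of_nonneg (a := ∑ b, _) (Finset.sum_nonneg fun b _ => sq_nonneg _)]
    exact mul_le_mul_of_nonneg_right (hm a) (Finset.sum_nonneg fun b _ => sq_nonneg _)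
  exact (abs_sub _ _).trans (by linarith)

lemma sum_mul_abs_le {α : Type*} [Fintype α] {x y : α → ℝ} {p q : ℝ}
    (hx : ∀ a, |x a| ≤ p) (hy : ∀ a, |y a| ≤ q) (hp : 0 ≤ p) :
    |∑ a, x a * y a| ≤ Fintype.card α * (p * q) := by
  refine (Finset.abs_sum_le_sum_abs _ _).trans ?_
  refine (Finset.sum_le_sum fun a _ => (abs_mul _ _).le.trans
    (mul_le_mul (hx a) (hy a) (abs_nonneg _) hp)).trans ?_
  simp

lemma abs_le_sqrt_sum_sq {α β : Type*} [Fintype α] [Fintype β] (f : α → β → ℝ) (i : α) (j : β) :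
    |f i j| ≤ √(∑ i, ∑ j, f i j ^ 2) := by
  refine Real.abs_le_sqrt ?_
  refine (Finset.single_le_sum (f := fun j => f i j ^ 2) (fun j _ => sq_nonneg _)
    (Finset.mem_univ j)).trans ?_
  exact Finset.single_le_sum (f := fun i => ∑ j, f i j ^ 2)
    (fun i _ => Finset.sum_nonneg fun j _ => sq_nonneg _) (Finset.mem_univ i)

/-- The off-diagonal block of a projector commuting with `M` solves a Sylvester equation up to
second order terms. -/
lemma abs_sylvester_error_le {r : ℝ} (hs : N.IsSymm) (hi : N * N = N)
    (htr : N.trace = Fintype.card ι) (hcomm : M * N = N * M)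
    (hM : ∀ x y, |M x y - diagonal (Sum.elim l m) x y| ≤ r) (hr : 0 ≤ r) (i : κ) (a : ι) :
    |(l a - m i) * N (.inr i) (.inl a) - M (.inr i) (.inl a)| ≤ Fintype.card (ι ⊕ κ) *
      ((∑ a, (1 - N (.inl a) (.inl a))) * √(∑ i, ∑ a, M (.inr i) (.inl a) ^ 2) +
        r * √(∑ i, ∑ a, N (.inr i) (.inl a) ^ 2)) := by
  set t := ∑ a, (1 - N (.inl a) (.inl a)) with ht
  set b := √(∑ i, ∑ a, M (.inr i) (.inl a) ^ 2) with hb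
  set f := √(∑ i, ∑ a, N (.inr i) (.inl a) ^ 2) with hf
  have ht0 : 0 ≤ t := Finset.sum_nonneg fun a _ => sub_nonneg.2 (proj_diag_le_one hs hi _)
  have hb' : ∀ i a, |M (.inr i) (.inl a)| ≤ b :=
    abs_le_sqrt_sum_sq (fun i a => M (.inr i) (.inl a))
  have hf' : ∀ i a, |N (.inr i) (.inl a)| ≤ f :=
    abs_le_sqrt_sum_sq (fun i a => N (.inr i) (.inl a))
  have hb0 : 0 ≤ b := Real.sqrt_nonneg _
  have hf0 : 0 ≤ f := Real.sqrt_nonneg _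
  have hK : ∀ a b, |(1 - N) (.inl a) (.inl b)| ≤ t := fun a b => by
    refine (abs_le_sqrt_sum_sq (fun a b => (1 - N) (.inl a) (.inl b)) a b).trans ?_
    exact (Real.sqrt_le_sqrt (sum_sq_top_le hs hi)).trans (Real.sqrt_sq ht0).le
  have hG : ∀ i j, |N (.inr i) (.inr j)| ≤ t := fun i j => by
    refine (abs_le_sqrt_sum_sq (fun i j => N (.inr i) (.inr j)) i j).trans ?_
    refine (Real.sqrt_le_sqrt (sum_sq_bot_le hs hi)).trans ?_
    rw [sum_bot_eq htr]
    exact (Real.sqrt_sq ht0).le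
  -- Entry `(i, a)` of `M N = N M`, with the diagonal blocks of `M` written as eigenvalues plus
  -- error and the top block of `N` as `1 - (1 - N)`. Each of the four sums is a product of two
  -- small factors.
  have key : (l a - m i) * N (.inr i) (.inl a) - M (.inr i) (.inl a) =
      -(∑ c, M (.inr i) (.inl c) * (1 - N) (.inl c) (.inl a)) +
      (∑ j, (M (.inr i) (.inr j) - diagonal (Sum.elim l m) (.inr i) (.inr j)) *
        N (.inr j) (.inl a)) -
      (∑ c, N (.inr i) (.inl c) * (M (.inl c) (.inl a) -
        diagonal (Sum.elim l m) (.inl c) (.inl a))) -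
      ∑ j, N (.inr i) (.inr j) * M (.inr j) (.inl a) := by
    have h := congr_fun (congr_fun hcomm (.inr i)) (.inl a)
    simp only [Matrix.mul_apply, Fintype.sum_sum_type] at h
    simp only [Matrix.sub_apply, mul_sub, sub_mul, Finset.sum_sub_distrib, diagonal_apply,
      Matrix.one_apply, Sum.inl.injEq, Sum.inr.injEq, Sum.elim_inl, Sum.elim_inr, ite_mul, mul_ite,
      mul_one, mul_zero, zero_mul, Finset.sum_ite_eq, Finset.sum_ite_eq', Finset.mem_univ, if_true]
    linarith
  have e1 := sum_mul_abs_le (fun c => hb' i c) (fun c => hK c a) hb0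
  have e2 := sum_mul_abs_le (fun j => hM (.inr i) (.inr j)) (fun j => hf' j a) hr
  have e3 := sum_mul_abs_le (fun c => hf' i c) (fun c => hM (.inl c) (.inl a)) hf0
  have e4 := sum_mul_abs_le (fun j => hG i j) (fun j => hb' j a) ht0
  rw [key, Fintype.card_sum, Nat.cast_add]
  rw [abs_le] at *
  constructor <;> nlinarith

/-- Factor `y² - w² = (y - w) (y + w)` and apply the arithmetic-geometric mean inequality with
weight `θ`, which balances the two terms. -/
lemma abs_sub_le_of_quadratic_error {α : Type*} [Fintype α] {y w : α → ℝ} {θ : ℝ} (hθ : 0 < θ)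
    (h : ∑ a, (y a - w a) ^ 2 ≤ θ ^ 2 * (∑ a, w a ^ 2 + ∑ a, y a ^ 2)) :
    |∑ a, y a ^ 2 - ∑ a, w a ^ 2| ≤ 2 * θ * (∑ a, w a ^ 2 + ∑ a, y a ^ 2) := by
  have hp : ∀ a, |y a ^ 2 - w a ^ 2| ≤ (y a - w a) ^ 2 / θ + θ * (w a ^ 2 + y a ^ 2) := fun a => by
    have e : y a ^ 2 - w a ^ 2 = (y a - w a) * (y a + w a) := by ring
    rw [e, ← sub_nonneg, abs_mul, ← sq_abs (y a - w a)]
    have h2 : |y a + w a| ^ 2 ≤ 2 * (w a ^ 2 + y a ^ 2) := by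
      rw [sq_abs]; nlinarith [sq_nonneg (y a - w a)]
    have h3 : |y a - w a| ^ 2 / θ + θ * (w a ^ 2 + y a ^ 2) - |y a - w a| * |y a + w a| =
        (|y a - w a| - θ * |y a + w a| / 2) ^ 2 / θ + θ * (w a ^ 2 + y a ^ 2) -
          θ * |y a + w a| ^ 2 / 4 := by
      field_simp
      ring
    rw [h3]
    have : 0 ≤ (|y a - w a| - θ * |y a + w a| / 2) ^ 2 / θ := by positivity
    have h4 := mul_le_mul_of_nonneg_left h2 hθ.le
    have h5 : 0 ≤ θ * (w a ^ 2 + y a ^ 2) := by positivity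
    linarith
  rw [← Finset.sum_sub_distrib]
  refine (Finset.abs_sum_le_sum_abs _ _).trans ((Finset.sum_le_sum fun a _ => hp a).trans ?_)
  rw [Finset.sum_add_distrib, ← Finset.sum_div, ← Finset.mul_sum, Finset.sum_add_distrib]
  have : (∑ a, (y a - w a) ^ 2) / θ ≤ θ * (∑ a, w a ^ 2 + ∑ a, y a ^ 2) := by
    rw [div_le_iff₀ hθ]; linarith
  linarith

lemma sq_sub_div_sqrt_le {d g x B E : ℝ} (hg : 0 < g) (hd : g ≤ d) (h : |d * x - B| ≤ E) :
    (√d * x - B / √d) ^ 2 ≤ E ^ 2 / g := by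
  have hsq := Real.sq_sqrt (hg.trans_le hd).le
  have hsq0 := (Real.sqrt_pos.2 (hg.trans_le hd)).ne'
  have e : √d * x - B / √d = (d * x - B) / √d := by
    rw [eq_div_iff hsq0, sub_mul, div_mul_cancel₀ _ hsq0]
    linear_combination x * hsq
  rw [e, div_pow, hsq, ← sq_abs]
  exact div_le_div₀ (sq_nonneg _) (pow_le_pow_left₀ (abs_nonneg _) h 2) hg hd

lemma sq_mul_add_sqrt_le {D ρ r β φ : ℝ} (hβ : 0 ≤ β) (hφ : 0 ≤ φ) :
    (D * (ρ * √β + r * √φ)) ^ 2 ≤ 2 * D ^ 2 * (ρ ^ 2 * β + r ^ 2 * φ) := by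
  have e : (ρ * √β + r * √φ) ^ 2 ≤ 2 * (ρ ^ 2 * β + r ^ 2 * φ) := by
    have a1 := Real.sq_sqrt hβ
    have a2 := Real.sq_sqrt hφ
    nlinarith [sq_nonneg (ρ * √β - r * √φ)]
  rw [mul_pow]
  nlinarith [sq_nonneg D]

/-- Of the two factors `t`, one is bounded by `ρ` and supplies the smallness; the other is bounded
by `2 φ` and makes the bound relative to `Y`. -/
lemma quadratic_remainder_le {L t ρ φ g θ Y : ℝ} (hg : 0 < g) (hL : 0 ≤ L) (ht : 0 ≤ t)
    (htρ : t ≤ ρ) (htφ : t ≤ 2 * φ) (hφ : 0 ≤ φ) (hφY : g * φ ≤ Y) (h : 4 * L * ρ ≤ θ * g) :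
    2 * L * t ^ 2 ≤ θ * Y := by
  have hρ : 0 ≤ ρ := ht.trans htρ
  have hθ : 0 ≤ θ := by
    have : 0 ≤ θ * g := le_trans (by positivity) h
    exact nonneg_of_mul_nonneg_left this hg
  calc 2 * L * t ^ 2 = 2 * L * (t * t) := by ring
    _ ≤ 2 * L * (ρ * (2 * φ)) := by gcongr
    _ = 4 * L * ρ * φ := by ring
    _ ≤ θ * g * φ := by gcongr
    _ = θ * (g * φ) := by ring
    _ ≤ θ * Y := by gcongr

/-- For `θ ≤ 1/10` the second estimate gives `Y ≤ 3/2 W`; the errors then add up to `6.5 θ W`, which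
is below `10 θ W`. -/
lemma relative_error_le {x Y W θ η : ℝ} (hθ0 : 0 < θ) (hθ1 : θ ≤ 1 / 10) (hθη : 10 * θ ≤ η)
    (hW0 : 0 ≤ W) (hA : |x - Y| ≤ θ * Y) (hB : |Y - W| ≤ 2 * θ * (W + Y)) :
    |x - W| ≤ η * W := by
  rw [abs_le] at hA hB
  have hYW : Y ≤ 3 / 2 * W := by nlinarith
  have hfin : 10 * θ * W ≤ η * W := mul_le_mul_of_nonneg_right hθη hW0
  have m1 : θ * Y ≤ θ * (3 / 2 * W) := mul_le_mul_of_nonneg_left hYW hθ0.le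
  have m2 : 0 ≤ θ * W := by positivity
  rw [abs_le]
  constructor <;> linarith

lemma weighted_error_le {D L ρ r g β φ W Y θ : ℝ} (hg : 0 < g) (hβW : β ≤ 2 * L * W)
    (hφY : g * φ ≤ Y) (hW : 0 ≤ W) (hY : 0 ≤ Y) (h1 : 4 * D ^ 4 * L * ρ ^ 2 / g ≤ θ ^ 2)
    (h2 : 2 * D ^ 4 * r ^ 2 / g ^ 2 ≤ θ ^ 2) :
    D ^ 2 * (2 * D ^ 2 * (ρ ^ 2 * β + r ^ 2 * φ) / g) ≤ θ ^ 2 * (W + Y) := by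
  calc D ^ 2 * (2 * D ^ 2 * (ρ ^ 2 * β + r ^ 2 * φ) / g)
      = 2 * D ^ 4 * ρ ^ 2 / g * β + 2 * D ^ 4 * r ^ 2 / g ^ 2 * (g * φ) := by field_simp
    _ ≤ 2 * D ^ 4 * ρ ^ 2 / g * (2 * L * W) + 2 * D ^ 4 * r ^ 2 / g ^ 2 * Y := by gcongr
    _ = 4 * D ^ 4 * L * ρ ^ 2 / g * W + 2 * D ^ 4 * r ^ 2 / g ^ 2 * Y := by ring
    _ ≤ θ ^ 2 * W + θ ^ 2 * Y := by gcongr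
    _ = θ ^ 2 * (W + Y) := by ring

/-- Divided by `√(l a - m i)`, the Sylvester equation says that `√(l a - m i) N_ia` is close to
`M_ia / √(l a - m i)`. The sums of squares of these two families are the quantities compared. -/
lemma abs_quadratic_sub_leadingTerm_le {g L θ r ρ : ℝ} (hg : 0 < g) (hθ0 : 0 < θ) (hr0 : 0 ≤ r)
    (hs : N.IsSymm) (hi : N * N = N) (htr : N.trace = Fintype.card ι) (hcomm : M * N = N * M)
    (hM : ∀ x y, |M x y - diagonal (Sum.elim l m) x y| ≤ r)
    (hδ : ∀ i a, g ≤ l a - m i) (hδL : ∀ i a, l a - m i ≤ 2 * L)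
    (htρ : ∑ a, (1 - N (.inl a) (.inl a)) ≤ ρ)
    (h3 : 4 * (Fintype.card (ι ⊕ κ) : ℝ) ^ 4 * L * ρ ^ 2 / g ≤ θ ^ 2)
    (h4 : 2 * (Fintype.card (ι ⊕ κ) : ℝ) ^ 4 * r ^ 2 / g ^ 2 ≤ θ ^ 2) :
    |∑ i, ∑ a, (l a - m i) * N (.inr i) (.inl a) ^ 2 - leadingTerm l m M| ≤
      2 * θ * (leadingTerm l m M + ∑ i, ∑ a, (l a - m i) * N (.inr i) (.inl a) ^ 2) := by
  set D : ℝ := ((Fintype.card (ι ⊕ κ) : ℕ) : ℝ) with hD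
  have hφY := gap_mul_sum_sq_le (N := N) hδ
  have hβW := sum_sq_le_leadingTerm (M := M) hg hδ hδL
  have hW0 := leadingTerm_nonneg (M := M) hg hδ
  set t := ∑ a, (1 - N (.inl a) (.inl a)) with ht
  set φ := ∑ i, ∑ a, N (.inr i) (.inl a) ^ 2 with hφ
  set β := ∑ i, ∑ a, M (.inr i) (.inl a) ^ 2 with hβ
  set Y := ∑ i, ∑ a, (l a - m i) * N (.inr i) (.inl a) ^ 2 with hY
  set W := leadingTerm l m M with hW
  have hφ0 : 0 ≤ φ := by positivity
  have hβ0 : 0 ≤ β := by positivity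
  have hY0 : 0 ≤ Y := (mul_nonneg hg.le hφ0).trans hφY
  have e1 : ∀ p : κ × ι, (√(l p.2 - m p.1) * N (.inr p.1) (.inl p.2)) ^ 2 =
      (l p.2 - m p.1) * N (.inr p.1) (.inl p.2) ^ 2 := fun p => by
    rw [mul_pow, Real.sq_sqrt (hg.le.trans (hδ _ _))]
  have e2 : ∀ p : κ × ι, (M (.inr p.1) (.inl p.2) / √(l p.2 - m p.1)) ^ 2 =
      M (.inr p.1) (.inl p.2) ^ 2 / (l p.2 - m p.1) := fun p => by
    rw [div_pow, Real.sq_sqrt (hg.le.trans (hδ _ _))]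
  have := abs_sub_le_of_quadratic_error (α := κ × ι)
    (y := fun p => √(l p.2 - m p.1) * N (.inr p.1) (.inl p.2))
    (w := fun p => M (.inr p.1) (.inl p.2) / √(l p.2 - m p.1)) hθ0
  simp only [e1, e2, Fintype.sum_prod_type] at this
  refine this ?_
  have hp : ∀ i a, (√(l a - m i) * N (.inr i) (.inl a) - M (.inr i) (.inl a) / √(l a - m i)) ^ 2
      ≤ 2 * D ^ 2 * (ρ ^ 2 * β + r ^ 2 * φ) / g := fun i a => by
    have e4 := abs_sylvester_error_le hs hi htr hcomm hM hr0 i a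
    rw [← ht, ← hβ, ← hφ, ← hD] at e4
    have e5 : t * √β + r * √φ ≤ ρ * √β + r * √φ := by gcongr
    have e6 := e4.trans (mul_le_mul_of_nonneg_left e5 (Nat.cast_nonneg _))
    refine (sq_sub_div_sqrt_le hg (hδ i a) e6).trans ?_
    refine div_le_div_of_nonneg_right ?_ hg.le
    exact sq_mul_add_sqrt_le hβ0 hφ0
  have hcard : (Fintype.card κ : ℝ) * Fintype.card ι ≤ D ^ 2 := by
    rw [hD, Fintype.card_sum, Nat.cast_add]
    have : (0 : ℝ) ≤ Fintype.card κ := by positivity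
    have : (0 : ℝ) ≤ Fintype.card ι := by positivity
    nlinarith
  have hsum : ∑ i, ∑ a, (√(l a - m i) * N (.inr i) (.inl a) -
      M (.inr i) (.inl a) / √(l a - m i)) ^ 2 ≤
      Fintype.card κ * Fintype.card ι * (2 * D ^ 2 * (ρ ^ 2 * β + r ^ 2 * φ) / g) := by
    refine (Finset.sum_le_sum fun i _ => Finset.sum_le_sum fun a _ => hp i a).trans ?_
    simp only [Finset.sum_const, Finset.card_univ, nsmul_eq_mul]
    exact (mul_assoc _ _ _).ge
  refine hsum.trans ((mul_le_mul_of_nonneg_right hcard (by positivity)).trans ?_)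
  have hW' : ∑ i, ∑ a, M (.inr i) (.inl a) ^ 2 / (l a - m i) = W := rfl
  rw [hW', ← hY]
  exact weighted_error_le hg hβW hφY hW0 hY0 h3 h4

/-- If `M` is close to the diagonal matrix of population eigenvalues and `N` is the top projector
of `M`, then the excess risk of `N` agrees with its leading term up to a small relative error. -/
theorem exists_abs_projExcess_sub_leadingTerm_le {c g η : ℝ} (hg : 0 < g) (hη : 0 < η)
    (hl : ∀ a, c + g ≤ l a) (hm : ∀ i, m i ≤ c) :
    ∃ r > 0, ∀ M N : Matrix (ι ⊕ κ) (ι ⊕ κ) ℝ, N.IsSymm → N * N = N →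
      N.trace = Fintype.card ι → M * N = N * M → ∑ a, M (.inl a) (.inl a) ≤ (M * N).trace →
      (∀ x y, |M x y - diagonal (Sum.elim l m) x y| ≤ r) →
      |projExcess l m N - leadingTerm l m M| ≤ η * leadingTerm l m M := by
  set L : ℝ := ∑ a, |l a| + ∑ i, |m i| with hL
  set D : ℝ := ((Fintype.card (ι ⊕ κ) : ℕ) : ℝ) with hD
  set θ : ℝ := min (1 / 10) (η / 10) with hθ
  have hθ0 : 0 < θ := by positivity
  have hL0 : 0 ≤ L := by positivity
  have hlL : ∀ a, |l a| ≤ L := fun a =>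
    (Finset.single_le_sum (f := fun a => |l a|) (fun _ _ => abs_nonneg _)
      (Finset.mem_univ a)).trans (le_add_of_nonneg_right (by positivity))
  have hmL : ∀ i, |m i| ≤ L := fun i =>
    (Finset.single_le_sum (f := fun i => |m i|) (fun _ _ => abs_nonneg _)
      (Finset.mem_univ i)).trans (le_add_of_nonneg_left (by positivity))
  have hδ : ∀ i a, g ≤ l a - m i := fun i a => by linarith [hl a, hm i]
  have hδL : ∀ i a, l a - m i ≤ 2 * L := fun i a => by
    have := (abs_le.1 (hlL a)).2
    have := (abs_le.1 (hmL i)).1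
    linarith
  have small : ∀ (f : ℝ → ℝ) (ε : ℝ), Continuous f → f 0 = 0 → 0 < ε →
      ∀ᶠ r in 𝓝[>] (0 : ℝ), f r ≤ ε := fun f ε hf h0 hε => by
    have : Tendsto f (𝓝[>] 0) (𝓝 0) := by
      simpa [h0] using (hf.tendsto 0).mono_left nhdsWithin_le_nhds
    exact (this.eventually (gt_mem_nhds hε)).mono fun _ h => le_of_lt h
  -- Here `2 D² r / g` is the a priori bound `ρ` on the displaced mass. All four expressions are
  -- continuous in `r` and vanish at `0`, so a single small `r` serves.
  obtain ⟨r, ⟨⟨⟨h1, h2⟩, h3⟩, h4⟩, hr⟩ := ((((small (fun r => 2 * D ^ 2 * r / g) (1 / 2) (by fun_prop)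
    (by simp) (by norm_num)).and (small (fun r => 4 * L * (2 * D ^ 2 * r / g) / g) θ (by fun_prop)
    (by simp) hθ0)).and (small (fun r => 4 * D ^ 4 * L * (2 * D ^ 2 * r / g) ^ 2 / g) (θ ^ 2)
    (by fun_prop) (by simp) (by positivity))).and (small (fun r => 2 * D ^ 4 * r ^ 2 / g ^ 2) (θ ^ 2)
    (by fun_prop) (by simp) (by positivity))).and self_mem_nhdsWithin |>.exists
  refine ⟨r, hr, fun M N hs hi htr hcomm hKF hM => ?_⟩
  have hr0 : 0 ≤ r := le_of_lt hr
  set t := ∑ a, (1 - N (.inl a) (.inl a)) with ht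
  have ht0 : 0 ≤ t := Finset.sum_nonneg fun a _ => sub_nonneg.2 (proj_diag_le_one hs hi _)
  set ρ := 2 * D ^ 2 * r / g with hρ
  have htρ : t ≤ ρ := by
    rw [hρ, le_div_iff₀ hg, mul_comm]
    exact (gap_mul_le_projExcess hs hi htr hl hm).trans (projExcess_le_of_close hs hi hKF hM)
  set φ := ∑ i, ∑ a, N (.inr i) (.inl a) ^ 2 with hφ
  set β := ∑ i, ∑ a, M (.inr i) (.inl a) ^ 2 with hβ
  set Y := ∑ i, ∑ a, (l a - m i) * N (.inr i) (.inl a) ^ 2 with hY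
  set W := leadingTerm l m M with hW
  have hφ0 : 0 ≤ φ := by positivity
  have hβ0 : 0 ≤ β := by positivity
  -- At least half of the displaced mass sits in the off-diagonal block: the rest is at most `t²`,
  -- and `t² ≤ t / 2` because `ρ ≤ 1/2`.
  have htφ : t ≤ 2 * φ := by
    have e : t = ∑ a, ∑ b, (1 - N) (.inl a) (.inl b) ^ 2 + φ := by
      rw [ht, hφ, Finset.sum_comm (f := fun i a => N (.inr i) (.inl a) ^ 2),
        ← Finset.sum_add_distrib]
      exact Finset.sum_congr rfl fun a _ => one_sub_diag_eq hs hi a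
    have := sum_sq_top_le hs hi
    rw [← ht] at this
    have h5 : t ^ 2 ≤ 1 / 2 * t := by
      rw [sq]
      exact mul_le_mul_of_nonneg_right (htρ.trans h1) ht0
    linarith
  have hφY : g * φ ≤ Y := gap_mul_sum_sq_le hδ
  have hW0 : 0 ≤ W := leadingTerm_nonneg hg hδ
  have hY0 : 0 ≤ Y := (mul_nonneg hg.le hφ0).trans hφY
  have hA : |projExcess l m N - Y| ≤ θ * Y := by
    refine (abs_projExcess_sub_le hs hi htr hlL hmL hL0).trans ?_
    exact quadratic_remainder_le hg hL0 ht0 htρ htφ hφ0 hφY ((div_le_iff₀ hg).1 h2)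
  have hB : |Y - W| ≤ 2 * θ * (W + Y) :=
    abs_quadratic_sub_leadingTerm_le hg hθ0 hr0 hs hi htr hcomm hM hδ hδL htρ h3 h4
  exact relative_error_le hθ0 (min_le_left _ _)
    (by linarith [min_le_right (1 / 10 : ℝ) (η / 10)]) hW0 hA hB

end Perturbation

/-! ### Top projectors and Ky Fan's inequality -/

section Projector

variable {ι κ : Type*} [Fintype ι] [Fintype κ] [DecidableEq ι] [DecidableEq κ]

/-- The orthogonal projector onto the span of the first block of columns of an orthogonal matrix. -/
noncomputable def blockProj (O : Matrix (ι ⊕ κ) (ι ⊕ κ) ℝ) : Matrix (ι ⊕ κ) (ι ⊕ κ) ℝ :=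
  O * diagonal (Sum.elim 1 0) * Oᵀ

variable {O : Matrix (ι ⊕ κ) (ι ⊕ κ) ℝ}

lemma blockProj_isSymm : (blockProj O).IsSymm := by
  simp [blockProj, Matrix.IsSymm, Matrix.transpose_mul, mul_assoc]

lemma conj_mul_conj {n : Type*} [Fintype n] [DecidableEq n] {O : Matrix n n ℝ} (h : Oᵀ * O = 1)
    (A B : Matrix n n ℝ) : (O * A * Oᵀ) * (O * B * Oᵀ) = O * (A * B) * Oᵀ := by
  calc _ = O * A * (Oᵀ * O) * B * Oᵀ := by simp only [mul_assoc]
    _ = _ := by rw [h]; simp only [mul_assoc, mul_one]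

lemma trace_conj {n : Type*} [Fintype n] [DecidableEq n] {O : Matrix n n ℝ} (h : Oᵀ * O = 1)
    (A : Matrix n n ℝ) : (O * A * Oᵀ).trace = A.trace := by
  rw [Matrix.trace_mul_comm, ← mul_assoc, h, one_mul]

lemma blockProj_mul_self (h : Oᵀ * O = 1) : blockProj O * blockProj O = blockProj O := by
  rw [blockProj, conj_mul_conj h, diagonal_mul_diagonal]
  congr 3
  ext x
  rcases x with x | x <;> simp

lemma trace_blockProj (h : Oᵀ * O = 1) : (blockProj O).trace = Fintype.card ι := by
  rw [blockProj, trace_conj h, trace_diagonal, Fintype.sum_sum_type]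
  simp

lemma blockProj_comm (h : Oᵀ * O = 1) (μ : ι ⊕ κ → ℝ) :
    (O * diagonal μ * Oᵀ) * blockProj O = blockProj O * (O * diagonal μ * Oᵀ) := by
  rw [blockProj, conj_mul_conj h, conj_mul_conj h, diagonal_mul_diagonal, diagonal_mul_diagonal]
  simp only [mul_comm]

/-- Ky Fan's inequality for the top projector of a symmetric matrix. -/
lemma sum_diag_le_trace_mul_blockProj (h : Oᵀ * O = 1) {μ : ι ⊕ κ → ℝ} {c : ℝ}
    (ht : ∀ a, c ≤ μ (.inl a)) (hb : ∀ i, μ (.inr i) ≤ c) :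
    ∑ a, (O * diagonal μ * Oᵀ) (.inl a) (.inl a) ≤
      ((O * diagonal μ * Oᵀ) * blockProj O).trace := by
  have h' : O * Oᵀ = 1 := mul_eq_one_comm.1 h
  have hr : ∀ x, ∑ z, O x z ^ 2 = 1 := fun x => by
    have := congr_fun (congr_fun h' x) x
    simpa [Matrix.mul_apply, sq] using this
  have hc : ∀ z, ∑ x, O x z ^ 2 = 1 := fun z => by
    have := congr_fun (congr_fun h z) z
    simpa [Matrix.mul_apply, sq] using this
  have e1 : ∀ x, (O * diagonal μ * Oᵀ) x x = ∑ z, μ z * O x z ^ 2 := fun x => by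
    rw [Matrix.mul_apply]
    refine Finset.sum_congr rfl fun z _ => ?_
    rw [mul_diagonal, transpose_apply]
    ring
  rw [blockProj, conj_mul_conj h, trace_conj h, diagonal_mul_diagonal, trace_diagonal]
  simp_rw [e1]
  rw [Finset.sum_comm]
  simp_rw [← Finset.mul_sum]
  rw [Fintype.sum_sum_type, Fintype.sum_sum_type]
  simp only [Sum.elim_inl, Sum.elim_inr, Pi.one_apply, Pi.zero_apply, mul_one, mul_zero,
    Finset.sum_const_zero, add_zero]
  -- The weights `∑ a, O (.inl a) z ^ 2` lie in `[0, 1]` and have total `card ι`, so the weighted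
  -- sum of the `μ z` is largest when all the weight is on the top block. The threshold `c` makes
  -- the comparison; no strict gap is needed.
  have hp : ∀ z, 0 ≤ ∑ a, O (.inl a) z ^ 2 := fun z => by positivity
  have hp1 : ∀ z, ∑ a, O (.inl a) z ^ 2 ≤ 1 := fun z => by
    rw [← hc z, Fintype.sum_sum_type]
    exact le_add_of_nonneg_right (by positivity)
  have hsum : ∑ b, ∑ a, O (.inl a) (.inl b) ^ 2 + ∑ i, ∑ a, O (.inl a) (.inr i) ^ 2 =
      Fintype.card ι := by
    rw [← Fintype.sum_sum_type (f := fun z => ∑ a, O (.inl a) z ^ 2), Finset.sum_comm]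
    simp [hr]
  have h1 : ∑ b, c * (1 - ∑ a, O (.inl a) (.inl b) ^ 2) ≤
      ∑ b, μ (.inl b) * (1 - ∑ a, O (.inl a) (.inl b) ^ 2) :=
    Finset.sum_le_sum fun b _ => mul_le_mul_of_nonneg_right (ht b) (sub_nonneg.2 (hp1 _))
  have h2 : ∑ i, μ (.inr i) * ∑ a, O (.inl a) (.inr i) ^ 2 ≤
      ∑ i, c * ∑ a, O (.inl a) (.inr i) ^ 2 :=
    Finset.sum_le_sum fun i _ => mul_le_mul_of_nonneg_right (hb i) (hp _)
  rw [← Finset.mul_sum] at h1 h2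
  simp only [mul_sub, mul_one, Finset.sum_sub_distrib] at h1
  simp only [Finset.sum_const, Finset.card_univ, nsmul_eq_mul, mul_one] at h1
  rw [← hsum, mul_add] at h1
  linarith

end Projector

/-! ### Centred Gaussian vectors in the eigenbasis of their covariance -/

section Gaussian

open scoped MatrixOrder

variable {ι : Type*} [Fintype ι] [DecidableEq ι]

lemma toEuclideanCLM_eigenvectorBasis {S : Matrix ι ι ℝ} (hS : S.IsHermitian) (i : ι) :
    (toEuclideanCLM (𝕜 := ℝ) S) (hS.eigenvectorBasis i) =
      hS.eigenvalues i • hS.eigenvectorBasis i := by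
  ext j
  simpa using congr_fun (hS.mulVec_eigenvectorBasis i) j

/-- The law of `‖h‖²` under a centred Gaussian measure is that of a weighted sum of squares of
independent standard Gaussian variables. -/
lemma map_sq_norm_multivariateGaussian {S : Matrix ι ι ℝ} (hS : S.PosSemidef) :
    (multivariateGaussian 0 S).map (fun h => ‖h‖ ^ 2) =
      (Measure.pi fun _ : ι => gaussianReal 0 1).map
        (fun x => ∑ i, hS.isHermitian.eigenvalues i * x i ^ 2) := by
  set b := hS.isHermitian.eigenvectorBasis with hb
  -- By rotation invariance the standard Gaussian has independent coordinates in the eigenbasis of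
  -- `S` too.
  rw [multivariateGaussian, stdGaussian_eq_map_pi_orthonormalBasis b, Measure.map_map,
    Measure.map_map]
  rotate_left
  · fun_prop
  · fun_prop
  · fun_prop
  · fun_prop
  congr 1
  ext x
  simp only [Function.comp_apply, zero_add]
  set y := ∑ i, x i • b i with hy
  have h1 : ‖(toEuclideanCLM (𝕜 := ℝ) (CFC.sqrt S)) y‖ ^ 2 =
      ⟪y, (toEuclideanCLM (𝕜 := ℝ) S) y⟫ := by
    rw [← real_inner_self_eq_norm_sq, ← ContinuousLinearMap.adjoint_inner_right,
      IsSelfAdjoint.adjoint_eq ((CFC.sqrt_nonneg S).isSelfAdjoint.map _),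
      ← ContinuousLinearMap.comp_apply, ← ContinuousLinearMap.mul_def, ← map_mul,
      CFC.sqrt_mul_sqrt_self _ hS.nonneg]
  have h2 : (toEuclideanCLM (𝕜 := ℝ) S) y =
      ∑ i, (hS.isHermitian.eigenvalues i * x i) • b i := by
    rw [hy, map_sum]
    refine Finset.sum_congr rfl fun i _ => ?_
    rw [map_smul]
    rw [hb, toEuclideanCLM_eigenvectorBasis, smul_smul, mul_comm]
  rw [h1, h2, hy, b.orthonormal.inner_sum]
  refine Finset.sum_congr rfl fun i _ => ?_
  simp
  ring

lemma integral_sq_inner_multivariateGaussian {S : Matrix ι ι ℝ} (hS : S.PosSemidef)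
    (A : EuclideanSpace ℝ ι) :
    ∫ h, ⟪A, h⟫ ^ 2 ∂(multivariateGaussian 0 S) =
      ∑ i, hS.isHermitian.eigenvalues i * ⟪hS.isHermitian.eigenvectorBasis i, A⟫ ^ 2 := by
  have h1 := covarianceBilin_multivariateGaussian (μ := 0) hS A A
  rw [covarianceBilin_apply IsGaussian.memLp_two_id, integral_id_multivariateGaussian'] at h1
  simp only [sub_zero, ← sq] at h1
  rw [h1]
  set b := hS.isHermitian.eigenvectorBasis with hb
  have h2 : (A : ι → ℝ) ⬝ᵥ S *ᵥ A = ⟪A, (toEuclideanCLM (𝕜 := ℝ) S) A⟫ := by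
    rw [inner_toEuclideanCLM]
  have h3 : (toEuclideanCLM (𝕜 := ℝ) S) A =
      ∑ i, (⟪b i, A⟫ * hS.isHermitian.eigenvalues i) • b i := by
    conv_lhs => rw [← b.sum_repr' A]
    rw [map_sum]
    refine Finset.sum_congr rfl fun i _ => ?_
    rw [map_smul, hb, toEuclideanCLM_eigenvectorBasis, smul_smul]
  rw [h2, h3, inner_sum]
  refine Finset.sum_congr rfl fun i _ => ?_
  rw [inner_smul_right, real_inner_comm]
  ring

lemma integral_sq_inner_le_of_eigenvalues_le {S : Matrix ι ι ℝ} (hS : S.PosSemidef) {c : ℝ}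
    (hc : ∀ j, hS.isHermitian.eigenvalues j ≤ c) {A : EuclideanSpace ℝ ι} (hA : ‖A‖ = 1) :
    ∫ h, ⟪A, h⟫ ^ 2 ∂(multivariateGaussian 0 S) ≤ c := by
  rw [integral_sq_inner_multivariateGaussian hS]
  calc _ ≤ ∑ j, c * ⟪hS.isHermitian.eigenvectorBasis j, A⟫ ^ 2 :=
        Finset.sum_le_sum fun j _ => mul_le_mul_of_nonneg_right (hc j) (sq_nonneg _)
    _ = c := by
        rw [← Finset.mul_sum, hS.isHermitian.eigenvectorBasis.sum_sq_inner_right, hA]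
        simp

/-- The largest variance of a linear functional under a centred Gaussian measure is the largest
eigenvalue of its covariance. -/
lemma exists_eigenvalue_eq_sSup_variance [Nonempty ι] {S : Matrix ι ι ℝ} (hS : S.PosSemidef) :
    ∃ i, sSup {r : ℝ | ∃ A : EuclideanSpace ℝ ι, ‖A‖ = 1 ∧
        r = ∫ h, ⟪A, h⟫ ^ 2 ∂(multivariateGaussian 0 S)} = hS.isHermitian.eigenvalues i ∧
      ∀ j, hS.isHermitian.eigenvalues j ≤ hS.isHermitian.eigenvalues i := by
  obtain ⟨i, hi⟩ := Finite.exists_max hS.isHermitian.eigenvalues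
  refine ⟨i, le_antisymm (csSup_le ⟨_, hS.isHermitian.eigenvectorBasis i, by simp, rfl⟩ ?_)
    (le_csSup ?_ ?_), hi⟩
  rotate_left
  · refine ⟨hS.isHermitian.eigenvalues i, ?_⟩
    rintro _ ⟨A, hA, rfl⟩
    exact integral_sq_inner_le_of_eigenvalues_le hS hi hA
  · refine ⟨hS.isHermitian.eigenvectorBasis i, by simp, ?_⟩
    rw [integral_sq_inner_multivariateGaussian hS]
    simp [hS.isHermitian.eigenvectorBasis.inner_eq_ite]
  · rintro _ ⟨A, hA, rfl⟩
    exact integral_sq_inner_le_of_eigenvalues_le hS hi hA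

end Gaussian

/-! ### Tails of weighted sums of squared Gaussians -/

section WeightedChiSquare

lemma gaussianPDFReal_mul_exp (a x : ℝ) :
    gaussianPDFReal 0 1 x • Real.exp (a * x ^ 2) =
      (√(2 * Real.pi))⁻¹ * Real.exp (-(1 / 2 - a) * x ^ 2) := by
  simp only [gaussianPDFReal, NNReal.coe_one, mul_one, sub_zero, smul_eq_mul]
  rw [mul_assoc, ← Real.exp_add]
  ring_nf

lemma integrable_exp_sq_gaussianReal {a : ℝ} (ha : a < 1 / 2) :
    Integrable (fun x => Real.exp (a * x ^ 2)) (gaussianReal 0 1) := by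
  rw [gaussianReal_of_var_ne_zero _ one_ne_zero,
    integrable_withDensity_iff_integrable_smul' (measurable_gaussianPDF 0 1)
      (.of_forall fun _ => gaussianPDF_lt_top)]
  simp only [toReal_gaussianPDF, gaussianPDFReal_mul_exp]
  exact (integrable_exp_neg_mul_sq (sub_pos.2 ha)).const_mul _

lemma integral_exp_sq_gaussianReal {a : ℝ} (ha : a < 1 / 2) :
    ∫ x, Real.exp (a * x ^ 2) ∂(gaussianReal 0 1) = (√(1 - 2 * a))⁻¹ := by
  rw [integral_gaussianReal_eq_integral_smul one_ne_zero]
  simp only [gaussianPDFReal_mul_exp]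
  rw [integral_const_mul, integral_gaussian, ← Real.sqrt_inv, ← Real.sqrt_mul (by positivity),
    ← Real.sqrt_inv]
  congr 1
  have : 1 / 2 - a ≠ 0 := (sub_pos.2 ha).ne'
  have : 1 - 2 * a ≠ 0 := by linarith [sub_pos.2 ha] |> fun h : 0 < 1 - 2 * a => h.ne'
  field_simp

/-- After squaring, `1 + 4a ≤ exp (4a)` and `(1 - 2a) (1 + 4a) = 1 + 2a (1 - 4a) ≥ 1`. This is where
`a ≤ 1/4` is used. -/
lemma inv_sqrt_le_exp {a : ℝ} (ha0 : 0 ≤ a) (ha : a ≤ 1 / 4) :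
    (√(1 - 2 * a))⁻¹ ≤ Real.exp (2 * a) := by
  rw [← Real.sqrt_inv, Real.sqrt_le_left (Real.exp_pos _).le, ← Real.exp_nat_mul, inv_le_comm₀
    (by linarith) (Real.exp_pos _), inv_le_iff_one_le_mul₀ (Real.exp_pos _)]
  have h := Real.add_one_le_exp ((2 : ℕ) * (2 * a))
  push_cast at h ⊢
  nlinarith

lemma integral_sq_gaussianReal : ∫ x, x ^ 2 ∂(gaussianReal 0 1) = 1 := by
  have := variance_id_gaussianReal (μ := 0) (v := 1)
  rw [variance_eq_integral (by fun_prop)] at this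
  simpa using this

lemma integrable_pow_gaussianReal (n : ℕ) : Integrable (fun x => x ^ n) (gaussianReal 0 1) := by
  rcases eq_or_ne n 0 with rfl | hn
  · simp
  exact ((memLp_id_gaussianReal (μ := 0) (v := 1) n).integrable_norm_pow hn).mono
    (by fun_prop) (by simp)

/-- The crude constant `6` suffices later. It comes from `exp y ≥ 1 + y + y²/2` at `y = x²/4` and
the known integral `E exp (x²/4) = √2`. -/
lemma integral_pow_four_gaussianReal_le : ∫ x, x ^ 4 ∂(gaussianReal 0 1) ≤ 6 := by
  have h : ∀ x : ℝ, x ^ 4 ≤ 32 * (Real.exp (1 / 4 * x ^ 2) - 1 - 1 / 4 * x ^ 2) := fun x => by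
    have := Real.quadratic_le_exp_of_nonneg (x := 1 / 4 * x ^ 2) (by positivity)
    nlinarith
  have hi := integrable_exp_sq_gaussianReal (a := 1 / 4) (by norm_num)
  have hi2 := (integrable_pow_gaussianReal 2).const_mul (1 / 4)
  have hi1 : Integrable (fun x => Real.exp (1 / 4 * x ^ 2) - 1) (gaussianReal 0 1) :=
    hi.sub (integrable_const 1)
  have hi3 : Integrable (fun x => 32 * (Real.exp (1 / 4 * x ^ 2) - 1 - 1 / 4 * x ^ 2))
      (gaussianReal 0 1) := (hi1.sub hi2).const_mul 32
  refine (integral_mono (integrable_pow_gaussianReal 4) hi3 h).trans ?_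
  rw [integral_const_mul, integral_sub hi1 hi2,
    integral_sub hi (integrable_const 1), integral_exp_sq_gaussianReal (by norm_num),
    integral_const_mul, integral_sq_gaussianReal]
  have h2 : (√(1 - 2 * (1 / 4) : ℝ))⁻¹ ≤ 1.43 := by
    rw [← Real.sqrt_inv, Real.sqrt_le_left (by norm_num)]
    norm_num
  simp
  linarith

/-- With `y = √(L/8)` the event contains `(y, 2y]`, where the density is at least its value at `2y`.
Since `L = (2y)²/2 + 6y²`, it remains to see that `y exp (6y²) > √(2π)`, which holds once `L ≥ log
10`. -/
lemma exp_neg_lt_gaussianReal_sq_gt {L : ℝ} (hL : Real.log 10 ≤ L) :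
    Real.exp (-L) < (gaussianReal 0 1).real {x | L / 8 < x ^ 2} := by
  -- Equivalent to `e ^ 23 ≤ 10 ^ 10`.
  have hlog : (2.3 : ℝ) ≤ Real.log 10 := by
    rw [Real.le_log_iff_exp_le (by norm_num)]
    have h1 : Real.exp 2.3 ^ 10 ≤ 10 ^ 10 := by
      rw [← Real.exp_nat_mul]
      have : Real.exp ((10 : ℕ) * 2.3) = Real.exp 1 ^ 23 := by
        rw [← Real.exp_nat_mul]; norm_num
      rw [this]
      exact (pow_le_pow_left₀ (Real.exp_pos 1).le Real.exp_one_lt_d9.le 23).trans (by norm_num)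
    exact le_of_pow_le_pow_left₀ (by norm_num) (by norm_num) h1
  have hL0 : 0 < L := by linarith
  set y := √(L / 8) with hy
  have hy2 : y ^ 2 = L / 8 := Real.sq_sqrt (by positivity)
  have hy0 : 0 < y := Real.sqrt_pos.2 (by positivity)
  have hy1 : 0.536 ≤ y := by
    rw [hy, Real.le_sqrt (by norm_num) (by positivity)]
    linarith
  have hsub : Set.Ioc y (2 * y) ⊆ {x | L / 8 < x ^ 2} := fun x hx => by
    rw [Set.mem_ofPred_eq, ← hy2]
    exact pow_lt_pow_left₀ hx.1 hy0.le two_ne_zero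
  refine lt_of_lt_of_le ?_ (measureReal_mono hsub)
  have hint : y * gaussianPDFReal 0 1 (2 * y) ≤ (gaussianReal 0 1).real (Set.Ioc y (2 * y)) := by
    rw [measureReal_def, gaussianReal_apply_eq_integral 0 one_ne_zero, ENNReal.toReal_ofReal
      (setIntegral_nonneg measurableSet_Ioc fun x _ => gaussianPDFReal_nonneg _ _ _)]
    have := setIntegral_mono_on (μ := volume) (s := Set.Ioc y (2 * y))
      (f := fun _ => gaussianPDFReal 0 1 (2 * y)) (g := gaussianPDFReal 0 1)
      (by simp) (integrable_gaussianPDFReal 0 1).integrableOn measurableSet_Ioc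
      (fun x hx => by
        simp only [gaussianPDFReal]
        gcongr
        · simpa using by linarith [hx.1, hy0]
        · exact hx.2)
    refine le_trans ?_ this
    rw [setIntegral_const]
    simp only [measureReal_def, Real.volume_Ioc, smul_eq_mul]
    rw [ENNReal.toReal_ofReal (by linarith)]
    apply le_of_eq
    ring
  refine lt_of_lt_of_le ?_ hint
  simp only [gaussianPDFReal, NNReal.coe_one, mul_one, sub_zero]
  have e1 : -L = -(2 * y) ^ 2 / 2 - 6 * y ^ 2 := by linarith
  rw [e1, Real.exp_sub, div_lt_iff₀ (Real.exp_pos _)]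
  have hpi : √(2 * Real.pi) < 2.6 := by
    rw [Real.sqrt_lt' (by norm_num)]
    linarith [Real.pi_lt_d2]
  have hpi0 : 0 < √(2 * Real.pi) := by positivity
  have hexp : 5 ≤ Real.exp (6 * y ^ 2) := by
    have h1 : (1.7 : ℝ) ≤ 6 * y ^ 2 := by nlinarith
    have h2 := Real.sum_le_exp_of_nonneg (x := 1.7) (by norm_num) 5
    refine le_trans ?_ (h2.trans (Real.exp_le_exp.2 h1))
    norm_num [Finset.sum_range_succ, Nat.factorial]
  have h3 : 1 < y * (√(2 * Real.pi))⁻¹ * Real.exp (6 * y ^ 2) := by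
    rw [← div_eq_mul_inv, div_mul_eq_mul_div, one_lt_div hpi0]
    nlinarith
  have h4 := mul_lt_mul_of_pos_left h3 (Real.exp_pos (-(2 * y) ^ 2 / 2))
  linarith

variable {ι : Type*} [Fintype ι] {s : ι → ℝ}

lemma integrable_comp_eval_gaussian {f : ℝ → ℝ} (hf : Integrable f (gaussianReal 0 1)) (i : ι) :
    Integrable (fun x : ι → ℝ => f (x i)) (Measure.pi fun _ => gaussianReal 0 1) :=
  (measurePreserving_eval (fun _ : ι => gaussianReal 0 1) i).integrable_comp_of_integrable hf

lemma integral_comp_eval_gaussian {f : ℝ → ℝ} (hf : Integrable f (gaussianReal 0 1)) (i : ι) :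
    ∫ x : ι → ℝ, f (x i) ∂(Measure.pi fun _ => gaussianReal 0 1) = ∫ x, f x ∂(gaussianReal 0 1) :=
  integral_comp_eval hf.aestronglyMeasurable

/-- Upper tail of a weighted sum of squares of independent standard Gaussian variables. -/
lemma weightedChiSq_upper_tail (hs : ∀ i, 0 ≤ s i) {T : ℝ} (hT : ∀ i, s i ≤ T) (hT0 : 0 < T)
    {δ : ℝ} (hδ : 0 < δ) :
    (Measure.pi fun _ : ι => gaussianReal 0 1).real
      {x | 2 * (∑ i, s i + 2 * T * Real.log (1 / δ)) ≤ ∑ i, s i * x i ^ 2} ≤ δ := by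
  have ha : ∀ i, s i / (4 * T) ≤ 1 / 4 := fun i => by
    rw [div_le_div_iff₀ (by positivity) (by norm_num)]
    linarith [hT i]
  have hexp : ∀ x : ι → ℝ, Real.exp (1 / (4 * T) * ∑ i, s i * x i ^ 2) =
      ∏ i, Real.exp (s i / (4 * T) * x i ^ 2) := fun x => by
    rw [← Real.exp_sum, Finset.mul_sum]
    congr 1
    exact Finset.sum_congr rfl fun i _ => by ring
  have hint : Integrable (fun x : ι → ℝ => Real.exp (1 / (4 * T) * ∑ i, s i * x i ^ 2))
      (Measure.pi fun _ : ι => gaussianReal 0 1) := by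
    simp_rw [hexp]
    exact Integrable.fintype_prod (f := fun i x => Real.exp (s i / (4 * T) * x ^ 2))
      fun i => integrable_exp_sq_gaussianReal (by linarith [ha i])
  -- Chernoff at `1 / (4T)`, which keeps every exponent `s i / (4T)` at most `1/4`. The moment
  -- generating function is then at most `exp (∑ s i / (2T))`, exactly what the trace part of the
  -- threshold cancels.
  refine (measure_ge_le_exp_mul_mgf _ (t := 1 / (4 * T)) (by positivity) hint).trans ?_
  have hmgf : mgf (fun x : ι → ℝ => ∑ i, s i * x i ^ 2)
      (Measure.pi fun _ : ι => gaussianReal 0 1) (1 / (4 * T)) ≤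
      Real.exp (∑ i, 2 * (s i / (4 * T))) := by
    rw [mgf]
    simp_rw [hexp]
    rw [integral_fintype_prod_eq_prod (f := fun i x => Real.exp (s i / (4 * T) * x ^ 2)),
      Real.exp_sum]
    refine Finset.prod_le_prod (fun i _ => integral_nonneg fun x => (Real.exp_pos _).le)
      fun i _ => ?_
    rw [integral_exp_sq_gaussianReal (by linarith [ha i])]
    exact inv_sqrt_le_exp (div_nonneg (hs i) (by positivity)) (ha i)
  refine (mul_le_mul_of_nonneg_left hmgf (Real.exp_pos _).le).trans ?_
  rw [← Real.exp_add, ← Finset.mul_sum, ← Finset.sum_div]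
  have : -(1 / (4 * T)) * (2 * (∑ i, s i + 2 * T * Real.log (1 / δ))) +
      2 * ((∑ i, s i) / (4 * T)) = Real.log δ := by
    rw [one_div δ, Real.log_inv]
    field_simp
    ring
  rw [this, Real.exp_log hδ]

/-- Cauchy–Schwarz with weights `s`. It reduces the second moment of the sum to fourth moments of
single coordinates, so no cross terms have to be computed. -/
lemma weightedChiSq_sq_le (hs : ∀ i, 0 ≤ s i) (x : ι → ℝ) :
    (∑ i, s i * x i ^ 2) ^ 2 ≤ (∑ i, s i) * ∑ i, s i * x i ^ 4 := by
  have h := Finset.sum_sq_le_sum_mul_sum_of_sq_le_mul Finset.univ (r := fun i => s i * x i ^ 2)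
    (f := s) (g := fun i => s i * x i ^ 4) (fun i _ => hs i)
    (fun i _ => mul_nonneg (hs i) (by positivity)) (fun i _ => by apply le_of_eq; ring)
  exact h

/-- A Paley–Zygmund lower bound. -/
lemma weightedChiSq_lower_tail (hs : ∀ i, 0 ≤ s i) (hE : 0 < ∑ i, s i) :
    1 / 10 < (Measure.pi fun _ : ι => gaussianReal 0 1).real
      {x | (∑ i, s i) / 16 < ∑ i, s i * x i ^ 2} := by
  set ρ := Measure.pi fun _ : ι => gaussianReal 0 1 with hρ
  set E := ∑ i, s i with hEdef
  set A := {x : ι → ℝ | E / 16 < ∑ i, s i * x i ^ 2} with hA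
  have hAm : MeasurableSet A := measurableSet_lt (by fun_prop) (by fun_prop)
  have hZ : Integrable (fun x : ι → ℝ => ∑ i, s i * x i ^ 2) ρ :=
    integrable_finsetSum _ fun i _ =>
      (integrable_comp_eval_gaussian (integrable_pow_gaussianReal 2) i).const_mul _
  have hZ4 : Integrable (fun x : ι → ℝ => ∑ i, s i * x i ^ 4) ρ :=
    integrable_finsetSum _ fun i _ =>
      (integrable_comp_eval_gaussian (integrable_pow_gaussianReal 4) i).const_mul _
  have hEZ : ∫ x, ∑ i, s i * x i ^ 2 ∂ρ = E := by
    rw [integral_finsetSum _ fun i _ =>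
      (integrable_comp_eval_gaussian (integrable_pow_gaussianReal 2) i).const_mul _]
    refine Finset.sum_congr rfl fun i _ => ?_
    rw [integral_const_mul, integral_comp_eval_gaussian (integrable_pow_gaussianReal 2),
      integral_sq_gaussianReal, mul_one]
  have hEZ4 : ∫ x, ∑ i, s i * x i ^ 4 ∂ρ ≤ 6 * E := by
    rw [integral_finsetSum _ fun i _ =>
      (integrable_comp_eval_gaussian (integrable_pow_gaussianReal 4) i).const_mul _, hEdef,
      Finset.mul_sum]
    refine Finset.sum_le_sum fun i _ => ?_
    rw [integral_const_mul, integral_comp_eval_gaussian (integrable_pow_gaussianReal 4), mul_comm 6]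
    exact mul_le_mul_of_nonneg_left integral_pow_four_gaussianReal_le (hs i)
  -- A pointwise form of Paley–Zygmund: on `A` it bounds `Z` by `5 Z² / (64 E) + 16 E / 5`, with
  -- equality at `Z = 32 E / 5`. Integrating gives `P(A) ≥ 75/512`, which exceeds `1/10`.
  have hpt : ∀ x : ι → ℝ, ∑ i, s i * x i ^ 2 ≤ E / 16 + 5 / 64 * ∑ i, s i * x i ^ 4 +
      16 / 5 * E * A.indicator 1 x := fun x => by
    by_cases hx : x ∈ A
    · rw [Set.indicator_of_mem hx]
      simp only [Pi.one_apply, mul_one]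
      have h := weightedChiSq_sq_le hs x
      rw [← hEdef] at h
      set Z := ∑ i, s i * x i ^ 2
      have h2 : Z ≤ 5 / (64 * E) * Z ^ 2 + 16 / 5 * E := by
        have : 5 / (64 * E) * Z ^ 2 + 16 / 5 * E - Z =
            5 / (64 * E) * (Z - 32 / 5 * E) ^ 2 := by
          field_simp
          ring
        have h3 : 0 ≤ 5 / (64 * E) * (Z - 32 / 5 * E) ^ 2 := by positivity
        linarith
      have h4 : 5 / (64 * E) * Z ^ 2 ≤ 5 / (64 * E) * (E * ∑ i, s i * x i ^ 4) :=
        mul_le_mul_of_nonneg_left h (by positivity)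
      have h5 : 5 / (64 * E) * (E * ∑ i, s i * x i ^ 4) = 5 / 64 * ∑ i, s i * x i ^ 4 := by
        field_simp
      linarith
    · rw [Set.indicator_of_notMem hx]
      have h1 : ∑ i, s i * x i ^ 2 ≤ E / 16 := not_lt.1 hx
      have h2 : 0 ≤ ∑ i, s i * x i ^ 4 :=
        Finset.sum_nonneg fun i _ => mul_nonneg (hs i) (by positivity)
      linarith
  have hind : Integrable (A.indicator (1 : (ι → ℝ) → ℝ)) ρ :=
    (integrable_const (1 : ℝ)).indicator hAm
  have h1 : Integrable (fun x : ι → ℝ => E / 16 + 5 / 64 * ∑ i, s i * x i ^ 4) ρ :=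
    (integrable_const (E / 16)).add (hZ4.const_mul (5 / 64))
  have h2 : Integrable (fun x : ι → ℝ => 16 / 5 * E * A.indicator 1 x) ρ :=
    hind.const_mul (16 / 5 * E)
  have hi := integral_mono hZ (h1.add h2) hpt
  simp only [Pi.add_apply] at hi
  rw [hEZ, integral_add h1 h2, integral_add (integrable_const (E / 16)) (hZ4.const_mul (5 / 64)),
    integral_const_mul, integral_const_mul, integral_indicator_one hAm] at hi
  simp only [integral_const, probReal_univ, one_smul] at hi
  nlinarith

instance : (gaussianReal 0 1).IsOpenPosMeasure :=
  (gaussianReal_absolutelyContinuous' 0 one_ne_zero).isOpenPosMeasure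

/-- The Gaussian measure charges every nonempty open set; a constant vector puts the sum at the
midpoint of `(a, b)`. -/
lemma weightedChiSq_Ioo_pos (hs : ∀ i, 0 ≤ s i) {i₀ : ι} (hi₀ : 0 < s i₀) {a b : ℝ} (ha : 0 ≤ a)
    (hab : a < b) :
    0 < (Measure.pi fun _ : ι => gaussianReal 0 1).real
      {x | a < ∑ i, s i * x i ^ 2 ∧ ∑ i, s i * x i ^ 2 < b} := by
  have hE : 0 < ∑ i, s i := hi₀.trans_le (Finset.single_le_sum (fun i _ => hs i) (Finset.mem_univ _))
  have hc : Continuous fun x : ι → ℝ => ∑ i, s i * x i ^ 2 := by fun_prop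
  refine ENNReal.toReal_pos (IsOpen.measure_ne_zero _ ?_ ?_) (measure_ne_top _ _)
  · exact (isOpen_lt continuous_const hc).inter (isOpen_lt hc continuous_const)
  · refine ⟨fun _ => √((a + b) / 2 / ∑ i, s i), ?_⟩
    simp only [Set.mem_ofPred_eq]
    rw [← Finset.sum_mul, Real.sq_sqrt (div_nonneg (by linarith) hE.le), mul_div_cancel₀ _ hE.ne']
    constructor <;> linarith

end WeightedChiSquare

/-! ### Distribution function of `‖H‖² / 2` -/

section GaussianNorm

variable {ι : Type*} [Fintype ι]

lemma measurableSet_weighted_sum_sq_mem (s : ι → ℝ) {B : Set ℝ} (hB : MeasurableSet B) :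
    MeasurableSet {x : ι → ℝ | ∑ i, s i * x i ^ 2 ∈ B} := by
  have h : Measurable fun x : ι → ℝ => ∑ i, s i * x i ^ 2 := by fun_prop
  exact h hB

variable [DecidableEq ι]

/-- The largest variance of a unit linear functional under the centred Gaussian measure with
covariance `S`. -/
noncomputable def maxVariance (S : Matrix ι ι ℝ) : ℝ :=
  sSup {r : ℝ | ∃ A : EuclideanSpace ℝ ι, ‖A‖ = 1 ∧
    r = ∫ h, ⟪A, h⟫ ^ 2 ∂(multivariateGaussian 0 S)}

variable {S : Matrix ι ι ℝ}

lemma measureReal_sq_norm_mem (hS : S.PosSemidef) {B : Set ℝ} (hB : MeasurableSet B) :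
    (multivariateGaussian 0 S).real {h | ‖h‖ ^ 2 ∈ B} =
      (Measure.pi fun _ : ι => gaussianReal 0 1).real
        {x | ∑ i, hS.isHermitian.eigenvalues i * x i ^ 2 ∈ B} := by
  have h : ((multivariateGaussian 0 S).map (fun h => ‖h‖ ^ 2)).real B =
      ((Measure.pi fun _ : ι => gaussianReal 0 1).map
        (fun x => ∑ i, hS.isHermitian.eigenvalues i * x i ^ 2)).real B := by
    rw [map_sq_norm_multivariateGaussian hS]
  rwa [map_measureReal_apply (by fun_prop) hB, map_measureReal_apply (by fun_prop) hB] at h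

lemma trace_eq_sum_eigenvalues_real (hS : S.PosSemidef) :
    S.trace = ∑ i, hS.isHermitian.eigenvalues i := by
  simpa using hS.isHermitian.trace_eq_sum_eigenvalues

variable [Nonempty ι]

lemma maxVariance_nonneg (hS : S.PosSemidef) : 0 ≤ maxVariance S := by
  obtain ⟨i, hi, -⟩ := exists_eigenvalue_eq_sSup_variance hS
  rw [maxVariance, hi]
  exact hS.eigenvalues_nonneg i

lemma one_sub_le_measureReal_sq_norm_le (hS : S.PosSemidef) {δ : ℝ} (hδ : 0 < δ) :
    1 - δ ≤ (multivariateGaussian 0 S).real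
      {h | ‖h‖ ^ 2 / 2 ≤ S.trace + 2 * maxVariance S * Real.log (1 / δ)} := by
  obtain ⟨i, hi, hmax⟩ := exists_eigenvalue_eq_sSup_variance hS
  have hT : maxVariance S = hS.isHermitian.eigenvalues i := hi
  have hset : {h : EuclideanSpace ℝ ι | ‖h‖ ^ 2 / 2 ≤
      S.trace + 2 * maxVariance S * Real.log (1 / δ)} =
      {h | ‖h‖ ^ 2 ∈ Set.Iic (2 * (S.trace + 2 * maxVariance S * Real.log (1 / δ)))} := by
    ext h
    simp only [Set.mem_ofPred_eq, Set.mem_Iic]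
    constructor <;> intro h <;> linarith
  rw [hset, measureReal_sq_norm_mem hS measurableSet_Iic]
  -- If the largest variance vanishes, the Chernoff exponent `1 / (4T)` is unavailable, but then the
  -- norm is almost surely zero.
  rcases (maxVariance_nonneg hS).eq_or_lt with h0 | h0
  · have hz : ∀ j, hS.isHermitian.eigenvalues j = 0 := fun j =>
      le_antisymm ((hmax j).trans (by rw [← hT, ← h0])) (hS.eigenvalues_nonneg j)
    rw [trace_eq_sum_eigenvalues_real hS, ← h0]
    simp only [hz]
    simp
    exact hδ.le
  · have h := weightedChiSq_upper_tail hS.eigenvalues_nonneg hmax (hT ▸ h0) hδ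
    rw [← hT, ← trace_eq_sum_eigenvalues_real hS] at h
    have hc : {x : ι → ℝ | ∑ i, hS.isHermitian.eigenvalues i * x i ^ 2 ∈
        Set.Iic (2 * (S.trace + 2 * maxVariance S * Real.log (1 / δ)))}ᶜ ⊆
        {x | 2 * (S.trace + 2 * maxVariance S * Real.log (1 / δ)) ≤
          ∑ i, hS.isHermitian.eigenvalues i * x i ^ 2} := fun x hx => by
      simp only [Set.mem_compl_iff, Set.mem_ofPred_eq, Set.mem_Iic, not_le] at hx ⊢
      exact hx.le
    have h2 := (measureReal_mono hc).trans h
    rw [probReal_compl_eq_one_sub (measurableSet_weighted_sum_sq_mem _ measurableSet_Iic)] at h2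
    linarith

/-- The trace is at most `32 t`, otherwise Paley–Zygmund makes the tail exceed `1/10 > δ`. Also `τ²
log (1/δ) ≤ 16 t`, otherwise the coordinate of the top eigenvalue alone makes it exceed `δ`. Hence
`64 = 32 + 2 · 16`. -/
lemma le_of_one_sub_le_measureReal_sq_norm_le (hS : S.PosSemidef) {δ : ℝ} (hδ : 0 < δ)
    (hδ1 : δ < 1 / 10) {t : ℝ}
    (ht : 1 - δ ≤ (multivariateGaussian 0 S).real {h | ‖h‖ ^ 2 / 2 ≤ t}) :
    1 / 64 * (S.trace + 2 * maxVariance S * Real.log (1 / δ)) ≤ t := by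
  obtain ⟨i, hi, hmax⟩ := exists_eigenvalue_eq_sSup_variance hS
  have hT : maxVariance S = hS.isHermitian.eigenvalues i := hi
  have hset : {h : EuclideanSpace ℝ ι | ‖h‖ ^ 2 / 2 ≤ t} =
      {h | ‖h‖ ^ 2 ∈ Set.Iic (2 * t)} := by
    ext h
    simp only [Set.mem_ofPred_eq, Set.mem_Iic]
    constructor <;> intro h <;> linarith
  rw [hset, measureReal_sq_norm_mem hS measurableSet_Iic] at ht
  set s := hS.isHermitian.eigenvalues with hs
  set ρ := Measure.pi fun _ : ι => gaussianReal 0 1 with hρ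
  have hs0 : ∀ j, 0 ≤ s j := hS.eigenvalues_nonneg
  have htail : ρ.real {x | 2 * t < ∑ j, s j * x j ^ 2} ≤ δ := by
    have : {x : ι → ℝ | 2 * t < ∑ j, s j * x j ^ 2} =
        {x | ∑ j, s j * x j ^ 2 ∈ Set.Iic (2 * t)}ᶜ := by
      ext x; simp
    rw [this, probReal_compl_eq_one_sub (measurableSet_weighted_sum_sq_mem _ measurableSet_Iic)]
    linarith
  have ht0 : 0 ≤ t := by
    by_contra! h
    have : {x : ι → ℝ | 2 * t < ∑ j, s j * x j ^ 2} = Set.univ := by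
      ext x
      have : 0 ≤ ∑ j, s j * x j ^ 2 :=
        Finset.sum_nonneg fun j _ => mul_nonneg (hs0 j) (sq_nonneg _)
      simp only [Set.mem_ofPred_eq, Set.mem_univ, iff_true]
      linarith
    rw [this, probReal_univ] at htail
    linarith
  have h1 : S.trace ≤ 32 * t := by
    by_contra! h
    rw [trace_eq_sum_eigenvalues_real hS] at h
    have h2 := weightedChiSq_lower_tail hs0 (by linarith : 0 < ∑ j, s j)
    have h3 : ρ.real {x | (∑ i, s i) / 16 < ∑ i, s i * x i ^ 2} ≤
        ρ.real {x | 2 * t < ∑ j, s j * x j ^ 2} := by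
      refine measureReal_mono fun x hx => ?_
      simp only [Set.mem_ofPred_eq] at hx ⊢
      linarith
    linarith
  have h2 : maxVariance S * Real.log (1 / δ) ≤ 16 * t := by
    by_contra! h
    have hL : Real.log 10 ≤ Real.log (1 / δ) := by
      refine Real.log_le_log (by norm_num) ?_
      rw [le_div_iff₀ hδ]
      linarith
    have h3 := exp_neg_lt_gaussianReal_sq_gt hL
    rw [one_div, Real.log_inv, neg_neg, Real.exp_log hδ, ← Real.log_inv, ← one_div] at h3
    have h4 : (gaussianReal 0 1).real {x | Real.log (1 / δ) / 8 < x ^ 2} =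
        ρ.real {x : ι → ℝ | Real.log (1 / δ) / 8 < x i ^ 2} :=
      ((measurePreserving_eval (fun _ : ι => gaussianReal 0 1) i).measureReal_preimage
        (measurableSet_lt (by fun_prop) (by fun_prop)).nullMeasurableSet).symm
    rw [h4] at h3
    refine absurd ((h3.trans_le (measureReal_mono fun x hx => ?_)).trans_le htail) (lt_irrefl _)
    simp only [Set.mem_ofPred_eq] at hx ⊢
    have h5 : s i * x i ^ 2 ≤ ∑ j, s j * x j ^ 2 :=
      Finset.single_le_sum (f := fun j => s j * x j ^ 2)
        (fun j _ => mul_nonneg (hs0 j) (sq_nonneg _)) (Finset.mem_univ i)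
    rw [hT] at h
    have h6 := mul_le_mul_of_nonneg_left hx.le (hs0 i)
    linarith
  linarith

lemma measureReal_sq_norm_Ioo_pos (hS : S.PosSemidef) (hτ : 0 < maxVariance S) {a b : ℝ}
    (ha : 0 ≤ a) (hab : a < b) :
    0 < (multivariateGaussian 0 S).real {h | a < ‖h‖ ^ 2 / 2 ∧ ‖h‖ ^ 2 / 2 < b} := by
  obtain ⟨i, hi, -⟩ := exists_eigenvalue_eq_sSup_variance hS
  have hset : {h : EuclideanSpace ℝ ι | a < ‖h‖ ^ 2 / 2 ∧ ‖h‖ ^ 2 / 2 < b} =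
      {h | ‖h‖ ^ 2 ∈ Set.Ioo (2 * a) (2 * b)} := by
    ext h
    simp only [Set.mem_ofPred_eq, Set.mem_Ioo]
    constructor <;> rintro ⟨h1, h2⟩ <;> constructor <;> linarith
  rw [hset, measureReal_sq_norm_mem hS measurableSet_Ioo]
  exact weightedChiSq_Ioo_pos hS.eigenvalues_nonneg (hi ▸ hτ : 0 < hS.isHermitian.eigenvalues i)
    (by linarith) (by linarith)

lemma measureReal_sq_norm_le_of_maxVariance_eq_zero (hS : S.PosSemidef) (hτ : maxVariance S = 0)
    {b : ℝ} (hb : 0 < b) :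
    (multivariateGaussian 0 S).real {h | ‖h‖ ^ 2 / 2 < b} = 1 := by
  obtain ⟨i, hi, hmax⟩ := exists_eigenvalue_eq_sSup_variance hS
  have hz : ∀ j, hS.isHermitian.eigenvalues j = 0 := fun j =>
    le_antisymm ((hmax j).trans (hi.symm.trans hτ).le) (hS.eigenvalues_nonneg j)
  have hset : {h : EuclideanSpace ℝ ι | ‖h‖ ^ 2 / 2 < b} =
      {h | ‖h‖ ^ 2 ∈ Set.Iio (2 * b)} := by
    ext h
    simp only [Set.mem_ofPred_eq, Set.mem_Iio]
    constructor <;> intro h <;> linarith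
  rw [hset, measureReal_sq_norm_mem hS measurableSet_Iio]
  simp [hz, hb]

/-- Excludes flat pieces of the distribution function at level `p`, on which quantiles could fail to
converge. If the largest variance is positive, every interval in `[0, ∞)` has mass. Otherwise the
law is a point mass at `0` and the distribution function jumps to `1`, so `p = 1` must be excluded.
-/
lemma lt_measureReal_of_le_measureReal (hS : S.PosSemidef) {p : ℝ} (hp0 : 0 < p) (hp1 : p ≤ 1)
    (hpτ : p = 1 → 0 < maxVariance S) {a b : ℝ} (hab : a < b)
    (ha : p ≤ (multivariateGaussian 0 S).real {h | ‖h‖ ^ 2 / 2 ≤ a}) :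
    p < (multivariateGaussian 0 S).real {h | ‖h‖ ^ 2 / 2 < b} := by
  have ha0 : 0 ≤ a := by
    by_contra! h
    have : {h : EuclideanSpace ℝ ι | ‖h‖ ^ 2 / 2 ≤ a} = ∅ := by
      ext x
      simp only [Set.mem_ofPred_eq, Set.mem_empty_iff_false, iff_false, not_le]
      exact h.trans_le (by positivity)
    rw [this, measureReal_empty] at ha
    linarith
  rcases (maxVariance_nonneg hS).eq_or_lt with h0 | h0
  · rw [measureReal_sq_norm_le_of_maxVariance_eq_zero hS h0.symm (ha0.trans_lt hab)]
    refine lt_of_le_of_ne hp1 fun h => ?_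
    have := hpτ h
    linarith
  · have h1 := measureReal_sq_norm_Ioo_pos hS h0 ha0 hab
    have hd : Disjoint {h : EuclideanSpace ℝ ι | ‖h‖ ^ 2 / 2 ≤ a}
        {h | a < ‖h‖ ^ 2 / 2 ∧ ‖h‖ ^ 2 / 2 < b} :=
      Set.disjoint_left.2 fun x hx hx' => not_lt.2 hx hx'.1
    have hV : Measurable fun h : EuclideanSpace ℝ ι => ‖h‖ ^ 2 / 2 := by fun_prop
    have hm : MeasurableSet {h : EuclideanSpace ℝ ι | a < ‖h‖ ^ 2 / 2 ∧ ‖h‖ ^ 2 / 2 < b} :=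
      hV measurableSet_Ioo
    have h2 := measureReal_union (μ := multivariateGaussian 0 S) hd hm
    have h3 : (multivariateGaussian 0 S).real ({h : EuclideanSpace ℝ ι | ‖h‖ ^ 2 / 2 ≤ a} ∪
        {h | a < ‖h‖ ^ 2 / 2 ∧ ‖h‖ ^ 2 / 2 < b}) ≤
        (multivariateGaussian 0 S).real {h | ‖h‖ ^ 2 / 2 < b} := by
      refine measureReal_mono fun x hx => ?_
      rcases hx with hx | hx
      · exact lt_of_le_of_lt hx hab
      · exact hx.2
    linarith

/-- The quantile at level `1` of `‖h‖² / 2` is infinite. -/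
lemma measureReal_sq_norm_le_lt_one (hS : S.PosSemidef) (hτ : 0 < maxVariance S) (t : ℝ) :
    (multivariateGaussian 0 S).real {h | ‖h‖ ^ 2 / 2 ≤ t} < 1 := by
  by_contra! h
  have := lt_measureReal_of_le_measureReal hS one_pos le_rfl (fun _ => hτ) (lt_add_one t) h
  exact absurd (measureReal_le_one) (not_le.2 this)

end GaussianNorm

/-! ### Convergence of quantiles -/

section Quantile

variable {Ω : Type*} [MeasurableSpace Ω] {P : Measure Ω}

lemma quantile_le_of_le {Z : Ω → ℝ} {p t : ℝ} (h : p ≤ P.real {ω | Z ω ≤ t}) :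
    quantile P Z p ≤ t :=
  sInf_le ⟨t, h, rfl⟩

lemma lt_of_lt_quantile {Z : Ω → ℝ} {p t : ℝ} (h : (t : EReal) < quantile P Z p) :
    P.real {ω | Z ω ≤ t} < p := by
  by_contra! h'
  exact absurd h (not_lt.2 (quantile_le_of_le h'))

lemma le_quantile_of_lt [IsFiniteMeasure P] {Z : Ω → ℝ} {p t : ℝ} (h : P.real {ω | Z ω ≤ t} < p) :
    (t : EReal) ≤ quantile P Z p := by
  refine le_sInf ?_
  rintro _ ⟨r, hr, rfl⟩
  rw [EReal.coe_le_coe_iff]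
  by_contra! hrt
  exact absurd (hr.trans (measureReal_mono fun ω hω => le_trans hω hrt.le)) (not_le.2 h)

lemma exists_of_quantile_lt {Z : Ω → ℝ} {p t : ℝ} (h : quantile P Z p < t) :
    ∃ r < t, p ≤ P.real {ω | Z ω ≤ r} := by
  obtain ⟨_, ⟨r, hr, rfl⟩, hrt⟩ := sInf_lt_iff.1 h
  exact ⟨r, EReal.coe_lt_coe_iff.1 hrt, hr⟩

/-- Convergence of rescaled quantiles. No measurability of the variables `Z n` is required. -/
lemma tendsto_mul_quantile [IsFiniteMeasure P] {E : Type*} [MeasurableSpace E] {μ : Measure E}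
    {Z : ℕ → Ω → ℝ} {V : E → ℝ} {p : ℝ}
    (hlow : ∀ c c', c' < c → μ.real {h | V h ≤ c} < p →
      ∀ᶠ n : ℕ in atTop, P.real {ω | n * Z n ω ≤ c'} < p)
    (hup : ∀ c c', c < c' → p < μ.real {h | V h < c} →
      ∀ᶠ n : ℕ in atTop, p ≤ P.real {ω | n * Z n ω ≤ c'})
    (hstrict : ∀ a b, a < b → p ≤ μ.real {h | V h ≤ a} → p < μ.real {h | V h < b}) :
    Tendsto (fun n : ℕ => ((n : ℝ) : EReal) * quantile P (Z n) p) atTop (𝓝 (quantile μ V p)) := by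
  have hset : ∀ n : ℕ, 0 < n → ∀ c ω, n * Z n ω ≤ c ↔ Z n ω ≤ c / n := fun n hn c ω => by
    rw [le_div_iff₀ (by positivity), mul_comm]
  have hmul : ∀ n : ℕ, 0 < n → ∀ c : ℝ, ((n : ℝ) : EReal) * ((c / n : ℝ) : EReal) = c := by
    intro n hn c
    rw [← EReal.coe_mul, mul_div_cancel₀ _ (by positivity)]
  have hn0 : ∀ n : ℕ, (0 : EReal) ≤ ((n : ℝ) : EReal) := fun n => by exact_mod_cast n.cast_nonneg
  -- In the order topology of `EReal` this also covers the limit `⊤`. Two reals inserted on each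
  -- side of the limit leave the slack `c' < c` or `c < c'` that the hypotheses require.
  refine tendsto_order.2 ⟨fun a ha => ?_, fun a ha => ?_⟩
  · obtain ⟨c, hac, hc⟩ := EReal.lt_iff_exists_real_btwn.1 ha
    obtain ⟨c', hac', hc'⟩ := EReal.lt_iff_exists_real_btwn.1 hac
    filter_upwards [hlow c c' (EReal.coe_lt_coe_iff.1 hc') (lt_of_lt_quantile hc),
      eventually_gt_atTop 0] with n hn hn1
    simp only [hset n hn1] at hn
    refine hac'.trans_le ?_
    rw [← hmul n hn1 c']
    exact mul_le_mul_of_nonneg_left (le_quantile_of_lt hn) (hn0 n)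
  · obtain ⟨c, hc, hca⟩ := EReal.lt_iff_exists_real_btwn.1 ha
    obtain ⟨c', hc', hca'⟩ := EReal.lt_iff_exists_real_btwn.1 hca
    obtain ⟨r, hr, hpr⟩ := exists_of_quantile_lt hc
    filter_upwards [hup c c' (EReal.coe_lt_coe_iff.1 hc') (hstrict r c hr hpr),
      eventually_gt_atTop 0] with n hn hn1
    simp only [hset n hn1] at hn
    refine lt_of_le_of_lt ?_ hca'
    rw [← hmul n hn1 c']
    exact mul_le_mul_of_nonneg_left (quantile_le_of_le hn) (hn0 n)

end Quantile

/-! ### Central limit theorem and relative errors -/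

section Convergence

variable {Ω : Type*} [MeasurableSpace Ω] {P : Measure Ω}

lemma aemeasurable_smul_sum {ι : Type*} [Fintype ι] {ξ : ℕ → Ω → EuclideanSpace ℝ ι}
    (hm : ∀ l, AEMeasurable (ξ l) P) (n : ℕ) :
    AEMeasurable (fun ω => (√n)⁻¹ • ∑ l ∈ Finset.range n, ξ l ω) P :=
  AEMeasurable.const_smul (M := ℝ) (Finset.aemeasurable_fun_sum _ fun l _ => hm l) _

/-- The Cramér–Wold device: the characteristic function at `t` is that of the projection on `t`,
evaluated at `1`, so the real central limit theorem applies. -/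
lemma charFun_map_smul_sum {ι : Type*} [Fintype ι] {ξ : ℕ → Ω → EuclideanSpace ℝ ι}
    (hm : ∀ l, AEMeasurable (ξ l) P) (t : EuclideanSpace ℝ ι) (n : ℕ) :
    charFun (P.map fun ω => (√n)⁻¹ • ∑ l ∈ Finset.range n, ξ l ω) t =
      charFun (P.map fun ω => (√n)⁻¹ * ∑ l ∈ Finset.range n, ⟪t, ξ l ω⟫) 1 := by
  have hm' : ∀ l, AEMeasurable (fun ω => ⟪t, ξ l ω⟫) P := fun l =>
    (by fun_prop : Measurable fun x : EuclideanSpace ℝ ι => ⟪t, x⟫).comp_aemeasurable (hm l)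
  rw [charFun_apply, charFun_apply, integral_map (aemeasurable_smul_sum hm n)
    (Measurable.aestronglyMeasurable (by fun_prop)), integral_map
    ((Finset.aemeasurable_fun_sum _ fun l _ => hm' l).const_mul _)
    (Measurable.aestronglyMeasurable (by fun_prop))]
  refine integral_congr_ae (.of_forall fun ω => ?_)
  simp only [real_inner_smul_left, sum_inner]
  simp [real_inner_comm]

variable [IsProbabilityMeasure P]

lemma tendsto_charFun_inv_sqrt_mul_sum {x : ℕ → Ω → ℝ} (hindep : iIndepFun x P)
    (hident : ∀ n, IdentDistrib (x n) (x 0) P P) (hL2 : MemLp (x 0) 2 P)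
    (hmean : ∫ ω, x 0 ω ∂P = 0) :
    Tendsto (fun n : ℕ => charFun (P.map fun ω => (√n)⁻¹ * ∑ l ∈ Finset.range n, x l ω) 1) atTop
      (𝓝 (Complex.exp (-((∫ ω, x 0 ω ^ 2 ∂P : ℝ) / 2 : ℂ)))) := by
  have hvar : Var[x 0; P] = ∫ ω, x 0 ω ^ 2 ∂P := by
    rw [variance_eq_integral (hident 0).aemeasurable_fst, hmean]
    simp
  have hlaw : HasLaw (id : ℝ → ℝ) (gaussianReal 0 Var[x 0; P].toNNReal)
    (gaussianReal 0 Var[x 0; P].toNNReal) := HasLaw.id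
  have key := (ProbabilityMeasure.tendsto_iff_tendsto_charFun.1
    (tendstoInDistribution_inv_sqrt_mul_sum_sub hlaw hL2 hindep hident).tendsto) 1
  simp only [ProbabilityMeasure.coe_mk, Measure.map_id, hmean, mul_zero, sub_zero,
    charFun_gaussianReal, hvar] at key
  have hnn : 0 ≤ ∫ ω, x 0 ω ^ 2 ∂P := by positivity
  simpa [max_eq_left hnn] using key

/-- The multivariate central limit theorem for centred vectors. -/
theorem tendstoInDistribution_inv_sqrt_smul_sum {ι : Type*} [Fintype ι] [DecidableEq ι]
    {S : Matrix ι ι ℝ} (hS : S.PosSemidef) {ξ : ℕ → Ω → EuclideanSpace ℝ ι}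
    (hindep : iIndepFun ξ P) (hident : ∀ n, IdentDistrib (ξ n) (ξ 0) P P)
    (hL2 : ∀ t, MemLp (fun ω => ⟪t, ξ 0 ω⟫) 2 P) (hmean : ∀ t, ∫ ω, ⟪t, ξ 0 ω⟫ ∂P = 0)
    (hcov : ∀ t : EuclideanSpace ℝ ι, ∫ ω, ⟪t, ξ 0 ω⟫ ^ 2 ∂P = t ⬝ᵥ S *ᵥ t) :
    TendstoInDistribution (fun (n : ℕ) ω => (√n)⁻¹ • ∑ l ∈ Finset.range n, ξ l ω) atTop id
      (fun _ => P) (multivariateGaussian 0 S) where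
  forall_aemeasurable := aemeasurable_smul_sum fun l => (hident l).aemeasurable_fst
  tendsto := by
    refine ProbabilityMeasure.tendsto_iff_tendsto_charFun.2 fun t => ?_
    have hm : Measurable fun x : EuclideanSpace ℝ ι => ⟪t, x⟫ := by fun_prop
    have key := tendsto_charFun_inv_sqrt_mul_sum (hindep.comp (fun _ x => ⟪t, x⟫) fun _ => hm)
      (fun n => (hident n).comp hm) (hL2 t) (hmean t)
    have h1 : ∫ ω, ((fun x => ⟪t, x⟫) ∘ ξ 0) ω ^ 2 ∂P = t ⬝ᵥ S *ᵥ t := hcov t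
    rw [h1] at key
    have e := charFun_map_smul_sum (P := P) (fun l => (hident l).aemeasurable_fst) t
    have e2 : charFun (multivariateGaussian 0 S) t =
        Complex.exp (-(((t ⬝ᵥ S *ᵥ t : ℝ) : ℂ) / 2)) := by
      rw [charFun_multivariateGaussian hS]
      simp
    simp only [ProbabilityMeasure.coe_mk, Measure.map_id, e, e2]
    exact key

variable {E : Type*} [MeasurableSpace E] [PseudoEMetricSpace E] [BorelSpace E]
  {μ : Measure E} [IsProbabilityMeasure μ]

lemma eventually_measureReal_lt_of_closed {Y : ℕ → Ω → E}
    (h : TendstoInDistribution Y atTop id (fun _ => P) μ) {F : Set E} (hF : IsClosed F) {p : ℝ}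
    (hp : μ.real F < p) : ∀ᶠ n in atTop, P.real {ω | Y n ω ∈ F} < p := by
  have h1 := ProbabilityMeasure.limsup_measure_closed_le_of_tendsto h.tendsto hF
  simp only [ProbabilityMeasure.coe_mk, Measure.map_id] at h1
  have h2 : μ F < ENNReal.ofReal p := by
    rw [← ENNReal.ofReal_toReal (measure_ne_top μ F)]
    exact (ENNReal.ofReal_lt_ofReal_iff (measureReal_nonneg.trans_lt hp)).2 hp
  filter_upwards [eventually_lt_of_limsup_lt (h1.trans_lt h2)] with n hn
  rw [Measure.map_apply_of_aemeasurable (h.forall_aemeasurable n) hF.measurableSet] at hn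
  exact (ENNReal.lt_ofReal_iff_toReal_lt (measure_ne_top _ _)).1 hn

lemma eventually_lt_measureReal_of_open {Y : ℕ → Ω → E}
    (h : TendstoInDistribution Y atTop id (fun _ => P) μ) {G : Set E} (hG : IsOpen G) {p : ℝ}
    (hp0 : 0 ≤ p) (hp : p < μ.real G) : ∀ᶠ n in atTop, p < P.real {ω | Y n ω ∈ G} := by
  have h1 := ProbabilityMeasure.le_liminf_measure_open_of_tendsto h.tendsto hG
  simp only [ProbabilityMeasure.coe_mk, Measure.map_id] at h1
  have h2 : ENNReal.ofReal p < μ G := (ENNReal.ofReal_lt_iff_lt_toReal hp0 (measure_ne_top _ _)).2 hp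
  filter_upwards [eventually_lt_of_lt_liminf (h2.trans_le h1)] with n hn
  rw [Measure.map_apply_of_aemeasurable (h.forall_aemeasurable n) hG.measurableSet] at hn
  exact (ENNReal.ofReal_lt_iff_lt_toReal hp0 (measure_ne_top _ _)).1 hn

/-- If `Z n` has the same limit law as `V (Y n)` up to relative errors tending to zero in
probability, its quantiles converge. -/
theorem tendsto_mul_quantile_of_relative_error {Y : ℕ → Ω → E}
    (h : TendstoInDistribution Y atTop id (fun _ => P) μ) {V : E → ℝ} (hV : Continuous V)
    (hV0 : ∀ y, 0 ≤ V y) {Z : ℕ → Ω → ℝ}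
    (herr : ∀ η > 0, Tendsto (fun n : ℕ => P.real {ω | ¬ |n * Z n ω - V (Y n ω)| ≤ η * V (Y n ω)})
      atTop (𝓝 0)) {p : ℝ} (hp : 0 ≤ p)
    (hstrict : ∀ a b, a < b → p ≤ μ.real {h | V h ≤ a} → p < μ.real {h | V h < b}) :
    Tendsto (fun n : ℕ => ((n : ℝ) : EReal) * quantile P (Z n) p) atTop (𝓝 (quantile μ V p)) := by
  refine tendsto_mul_quantile (fun c c' hc hlt => ?_) (fun c c' hc hlt => ?_) hstrict
  · obtain ⟨q, hq, hqp⟩ := exists_between hlt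
    -- For `c' < 0`, `η = 1` already forces `z ≥ 0`. Otherwise `η = (c - c') / (2c)` turns `w > c`
    -- into `z ≥ (1 - η) w > (c + c') / 2 > c'`.
    obtain ⟨η, hη0, hη⟩ : ∃ η > 0, ∀ z w : ℝ, 0 ≤ w → |z - w| ≤ η * w → z ≤ c' → w ≤ c := by
      rcases lt_or_ge c' 0 with h0 | h0
      · refine ⟨1, one_pos, fun z w hw hzw hz => ?_⟩
        rw [abs_le] at hzw
        linarith
      · have hcpos : 0 < c := by linarith
        refine ⟨(c - c') / (2 * c), div_pos (by linarith) (by linarith), fun z w hw hzw hz => ?_⟩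
        rw [abs_le] at hzw
        by_contra! hcw
        have e1 : (c - c') / (2 * c) * w = w / 2 - c' * w / (2 * c) := by
          field_simp
        have e2 : c' < w / 2 + c' * w / (2 * c) := by
          have : c' * w / (2 * c) = c' / 2 * (w / c) := by field_simp
          have h1 : 1 ≤ w / c := by rw [le_div_iff₀ hcpos]; linarith
          rw [this]
          nlinarith
        linarith [hzw.1]
    have h1 := eventually_measureReal_lt_of_closed h (isClosed_le hV continuous_const) hq
    filter_upwards [h1, (herr η hη0).eventually (gt_mem_nhds (sub_pos.2 hqp))] with n hn1 hn2
    have hsub : {ω | n * Z n ω ≤ c'} ⊆ {ω | Y n ω ∈ {y | V y ≤ c}} ∪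
        {ω | ¬ |n * Z n ω - V (Y n ω)| ≤ η * V (Y n ω)} := fun ω hω => by
      by_cases hg : |n * Z n ω - V (Y n ω)| ≤ η * V (Y n ω)
      · exact Or.inl (hη _ _ (hV0 _) hg hω)
      · exact Or.inr hg
    have := (measureReal_mono (μ := P) hsub).trans (measureReal_union_le _ _)
    simp only [Set.mem_ofPred_eq] at this
    linarith
  · obtain ⟨q, hpq, hq⟩ := exists_between hlt
    have hc0 : 0 < c := by
      by_contra! h0
      have : {y | V y < c} = ∅ := by
        ext y
        simp only [Set.mem_ofPred_eq, Set.mem_empty_iff_false, iff_false, not_lt]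
        exact h0.trans (hV0 y)
      rw [this, measureReal_empty] at hlt
      linarith
    -- With this relative error, `V < c` forces `n Z ≤ c + (c' - c) = c'`.
    have hη0 : 0 < (c' - c) / c := div_pos (by linarith) hc0
    have h1 := eventually_lt_measureReal_of_open h (isOpen_lt hV continuous_const)
      (hp.trans hpq.le) hq
    filter_upwards [h1, (herr _ hη0).eventually (gt_mem_nhds (sub_pos.2 hpq))] with n hn1 hn2
    have hsub : {ω | Y n ω ∈ {y | V y < c}} ⊆ {ω | n * Z n ω ≤ c'} ∪
        {ω | ¬ |n * Z n ω - V (Y n ω)| ≤ (c' - c) / c * V (Y n ω)} := fun ω hω => by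
      by_cases hg : |n * Z n ω - V (Y n ω)| ≤ (c' - c) / c * V (Y n ω)
      · refine Or.inl ?_
        simp only [Set.mem_ofPred_eq] at hω ⊢
        have e1 : (c' - c) / c * V (Y n ω) ≤ (c' - c) / c * c :=
          mul_le_mul_of_nonneg_left hω.le hη0.le
        rw [div_mul_cancel₀ _ hc0.ne'] at e1
        rw [abs_le] at hg
        linarith
      · exact Or.inr hg
    have := (measureReal_mono (μ := P) hsub).trans (measureReal_union_le _ _)
    simp only [Set.mem_ofPred_eq] at this
    linarith

end Convergence

/-! ### Coordinates in the population eigenbasis -/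

section Indices

variable {d k : ℕ}

/-- The top `k` indices followed by the bottom `d - k` indices. -/
noncomputable def splitIdx (hk : k < d) : Fin k ⊕ Fin (d - k) ≃ Fin d :=
  Equiv.ofBijective (Sum.elim (topIdx hk) botIdx) <| by
    rw [Fintype.bijective_iff_injective_and_card]
    refine ⟨?_, by simp; omega⟩
    rintro (a | a) (b | b) h <;>
      simp only [Sum.elim_inl, Sum.elim_inr, topIdx, botIdx, Fin.mk.injEq] at h
    · exact congr_arg _ (Fin.ext h)
    · have := a.isLt; omega
    · have := b.isLt; omega
    · exact congr_arg _ (Fin.ext (by omega))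

@[simp] lemma splitIdx_inl (hk : k < d) (j : Fin k) : splitIdx hk (.inl j) = topIdx hk j := rfl

@[simp] lemma splitIdx_inr (hk : k < d) (i : Fin (d - k)) : splitIdx hk (.inr i) = botIdx i := rfl

/-- The change of basis between two orthonormal bases, in block form. -/
noncomputable def overlap (hk : k < d)
    (u v : OrthonormalBasis (Fin d) ℝ (EuclideanSpace ℝ (Fin d))) :
    Matrix (Fin k ⊕ Fin (d - k)) (Fin k ⊕ Fin (d - k)) ℝ :=
  Matrix.of fun x y => ⟪u (splitIdx hk x), v (splitIdx hk y)⟫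

variable (hk : k < d) (u v : OrthonormalBasis (Fin d) ℝ (EuclideanSpace ℝ (Fin d)))

lemma overlap_transpose_mul_self : (overlap hk u v)ᵀ * overlap hk u v = 1 := by
  ext x y
  simp only [Matrix.mul_apply, transpose_apply, overlap, Matrix.of_apply]
  rw [(splitIdx hk).sum_comp fun z => ⟪u z, v (splitIdx hk x)⟫ * ⟪u z, v (splitIdx hk y)⟫]
  simp_rw [real_inner_comm (v (splitIdx hk x))]
  rw [u.sum_inner_mul_inner, v.inner_eq_ite, Matrix.one_apply]
  simp

lemma overlap_conj_diagonal_apply (μ : Fin d → ℝ) (x y : Fin k ⊕ Fin (d - k)) :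
    (overlap hk u v * diagonal (μ ∘ splitIdx hk) * (overlap hk u v)ᵀ) x y =
      ∑ z, ⟪u (splitIdx hk x), v z⟫ * μ z * ⟪u (splitIdx hk y), v z⟫ := by
  rw [Matrix.mul_apply, ← (splitIdx hk).sum_comp]
  refine Finset.sum_congr rfl fun z _ => ?_
  rw [mul_diagonal]
  rfl

lemma blockProj_overlap_diag (x : Fin k ⊕ Fin (d - k)) :
    blockProj (overlap hk u v) x x = ∑ j, ⟪u (splitIdx hk x), v (topIdx hk j)⟫ ^ 2 := by
  rw [blockProj, Matrix.mul_apply]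
  simp only [mul_diagonal, Fintype.sum_sum_type, Sum.elim_inl, Sum.elim_inr, Pi.one_apply,
    Pi.zero_apply, mul_one, mul_zero, zero_mul, Finset.sum_const_zero, add_zero, transpose_apply,
    overlap, Matrix.of_apply, splitIdx_inl, ← sq]

variable {u v}

lemma toEuclideanCLM_apply_eigen {M : Matrix (Fin d) (Fin d) ℝ} {μ : Fin d → ℝ}
    (hv : IsOrderedEigenbasis M v μ) (z : Fin d) :
    toEuclideanCLM (𝕜 := ℝ) M (v z) = μ z • v z := by
  ext j
  simpa using congr_fun (hv.2 z) j

lemma inner_toEuclideanCLM_eq_sum {M : Matrix (Fin d) (Fin d) ℝ} {μ : Fin d → ℝ}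
    (hv : IsOrderedEigenbasis M v μ) (a b : EuclideanSpace ℝ (Fin d)) :
    ⟪a, toEuclideanCLM (𝕜 := ℝ) M b⟫ = ∑ z, ⟪a, v z⟫ * μ z * ⟪b, v z⟫ := by
  conv_lhs => rw [← v.sum_repr' b]
  simp_rw [map_sum, map_smul, toEuclideanCLM_apply_eigen hv, inner_sum, inner_smul_right]
  refine Finset.sum_congr rfl fun z _ => ?_
  rw [real_inner_comm b]
  ring

/-- A matrix in the coordinates of `u`, in terms of its eigenbasis `v`. -/
lemma overlap_conj_eigenvalues_apply {M : Matrix (Fin d) (Fin d) ℝ} {μ : Fin d → ℝ}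
    (hv : IsOrderedEigenbasis M v μ) (x y : Fin k ⊕ Fin (d - k)) :
    (overlap hk u v * diagonal (μ ∘ splitIdx hk) * (overlap hk u v)ᵀ) x y =
      ⟪u (splitIdx hk x), toEuclideanCLM (𝕜 := ℝ) M (u (splitIdx hk y))⟫ := by
  rw [overlap_conj_diagonal_apply, inner_toEuclideanCLM_eq_sum hv]

lemma inner_empCovMatrix (x : ℕ → EuclideanSpace ℝ (Fin d)) (n : ℕ)
    (a b : EuclideanSpace ℝ (Fin d)) :
    ⟪a, toEuclideanCLM (𝕜 := ℝ) (empCovMatrix x n) b⟫ =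
      (n : ℝ)⁻¹ * ∑ l ∈ Finset.range n, ⟪a, x l⟫ * ⟪b, x l⟫ := by
  have h : ∀ p q : EuclideanSpace ℝ (Fin d), ⟪p, q⟫ = p.ofLp ⬝ᵥ q.ofLp := fun p q => by
    rw [EuclideanSpace.inner_eq_star_dotProduct, dotProduct_comm]
    simp
  rw [inner_toEuclideanCLM, empCovMatrix, smul_mulVec, dotProduct_smul, smul_eq_mul,
    sum_mulVec, dotProduct_sum]
  congr 1
  refine Finset.sum_congr rfl fun l _ => ?_
  rw [vecMulVec_mulVec, h, h]
  simp [dotProduct_comm, mul_comm]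

/-- Relative accuracy of the leading term of the excess risk, for matrices close to the population
covariance. -/
theorem exists_relative_error_le (hk1 : 1 ≤ k) {lam : Fin d → ℝ} (hlam : Antitone lam)
    (hgap : lam ⟨k, hk⟩ < lam ⟨k - 1, (Nat.sub_le k 1).trans_lt hk⟩) {η : ℝ} (hη : 0 < η) :
    ∃ r > 0, ∀ (M : Matrix (Fin d) (Fin d) ℝ)
      (v : OrthonormalBasis (Fin d) ℝ (EuclideanSpace ℝ (Fin d))) (μ : Fin d → ℝ),
      IsOrderedEigenbasis M v μ →
      (∀ x y : Fin d, |⟪u x, toEuclideanCLM (𝕜 := ℝ) M (u y)⟫ - if x = y then lam x else 0| ≤ r) →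
      |projExcess (fun a => lam (topIdx hk a)) (fun i : Fin (d - k) => lam (botIdx i))
          (blockProj (overlap hk u v)) -
        ∑ i, ∑ a, ⟪u (botIdx i), toEuclideanCLM (𝕜 := ℝ) M (u (topIdx hk a))⟫ ^ 2 /
          gap hk lam i a| ≤
      η * ∑ i, ∑ a, ⟪u (botIdx i), toEuclideanCLM (𝕜 := ℝ) M (u (topIdx hk a))⟫ ^ 2 /
          gap hk lam i a := by
  have htop : ∀ {f : Fin d → ℝ}, Antitone f → ∀ a : Fin k,
      f ⟨k - 1, (Nat.sub_le k 1).trans_lt hk⟩ ≤ f (topIdx hk a) := fun hf a => by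
    refine hf ?_
    have := a.isLt
    simp only [topIdx, Fin.mk_le_mk]
    omega
  have hbot : ∀ {f : Fin d → ℝ}, Antitone f → ∀ i : Fin (d - k), f (botIdx i) ≤ f ⟨k, hk⟩ :=
    fun hf i => by
    refine hf ?_
    simp only [botIdx, Fin.mk_le_mk]
    omega
  obtain ⟨r, hr, H⟩ := exists_abs_projExcess_sub_leadingTerm_le (sub_pos.2 hgap) hη
    (l := fun a => lam (topIdx hk a)) (m := fun i : Fin (d - k) => lam (botIdx i))
    (c := lam ⟨k, hk⟩) (fun a => by linarith [htop hlam a]) (hbot hlam)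
  refine ⟨r, hr, fun M v μ hv hM => ?_⟩
  have hO := overlap_transpose_mul_self hk u v
  have key := H (overlap hk u v * diagonal (μ ∘ splitIdx hk) * (overlap hk u v)ᵀ)
    (blockProj (overlap hk u v)) blockProj_isSymm (blockProj_mul_self hO) (trace_blockProj hO)
    (blockProj_comm hO _)
    -- The threshold is the `(k+1)`-st eigenvalue of `M` (index `k` from zero). Ties in the spectrum
    -- of `M` are harmless.
    (sum_diag_le_trace_mul_blockProj hO (c := μ ⟨k, hk⟩)
      (fun a => (hv.1 (by simp only [Fin.mk_le_mk]; omega)).trans (htop hv.1 a))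
      (fun i => hbot hv.1 i))
    (fun x y => by
      rw [overlap_conj_eigenvalues_apply hk hv]
      refine le_trans (le_of_eq ?_) (hM (splitIdx hk x) (splitIdx hk y))
      congr 2
      rw [diagonal_apply]
      simp only [EmbeddingLike.apply_eq_iff_eq]
      split_ifs
      · rcases x with x | x <;> rfl
      · rfl)
  simp only [leadingTerm, overlap_conj_eigenvalues_apply hk hv] at key
  exact key

end Indices

/-! ### The excess risk as a function of the projector -/

section Risk

variable {d k : ℕ} {Ω : Type*} [MeasurableSpace Ω] {P : Measure Ω}
  {X : Ω → EuclideanSpace ℝ (Fin d)}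

lemma integrable_inner_mul_inner (hX : AEMeasurable X P) (hX2 : Integrable (fun ω => ‖X ω‖ ^ 2) P)
    (a b : EuclideanSpace ℝ (Fin d)) : Integrable (fun ω => ⟪a, X ω⟫ * ⟪b, X ω⟫) P := by
  refine (hX2.const_mul (‖a‖ * ‖b‖)).mono' (by fun_prop) (.of_forall fun ω => ?_)
  rw [norm_mul]
  calc ‖⟪a, X ω⟫‖ * ‖⟪b, X ω⟫‖ ≤ (‖a‖ * ‖X ω‖) * (‖b‖ * ‖X ω‖) :=
        mul_le_mul (norm_inner_le_norm _ _) (norm_inner_le_norm _ _) (norm_nonneg _) (by positivity)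
    _ = ‖a‖ * ‖b‖ * ‖X ω‖ ^ 2 := by ring

lemma inner_covMatrix (hX : AEMeasurable X P) (hX2 : Integrable (fun ω => ‖X ω‖ ^ 2) P)
    (a b : EuclideanSpace ℝ (Fin d)) :
    ⟪a, toEuclideanCLM (𝕜 := ℝ) (covMatrix P X) b⟫ = ∫ ω, ⟪a, X ω⟫ * ⟪b, X ω⟫ ∂P := by
  have hint : ∀ i j, Integrable (fun ω => X ω i * X ω j) P := fun i j => by
    simpa [EuclideanSpace.inner_single_left] using
      integrable_inner_mul_inner hX hX2 (EuclideanSpace.single i 1) (EuclideanSpace.single j 1)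
  have h : ∀ (p : EuclideanSpace ℝ (Fin d)) ω, ⟪p, X ω⟫ = ∑ i, p i * X ω i := fun p ω => by
    simp [PiLp.inner_apply, mul_comm]
  have e : ∀ ω, ⟪a, X ω⟫ * ⟪b, X ω⟫ = ∑ i, ∑ j, (a i * b j) * (X ω i * X ω j) := fun ω => by
    rw [h, h, Finset.sum_mul_sum]
    exact Finset.sum_congr rfl fun i _ => Finset.sum_congr rfl fun j _ => by ring
  simp_rw [e]
  rw [integral_finsetSum _ fun i _ => integrable_finsetSum _ fun j _ => (hint i j).const_mul _,
    inner_toEuclideanCLM, dotProduct]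
  refine Finset.sum_congr rfl fun i _ => ?_
  rw [integral_finsetSum _ fun j _ => (hint i j).const_mul _, mulVec, dotProduct, Finset.mul_sum]
  refine Finset.sum_congr rfl fun j _ => ?_
  rw [integral_const_mul, covMatrix, Matrix.of_apply]
  ring

lemma integral_inner_mul_inner_eigen (hX : AEMeasurable X P)
    (hX2 : Integrable (fun ω => ‖X ω‖ ^ 2) P)
    {u : OrthonormalBasis (Fin d) ℝ (EuclideanSpace ℝ (Fin d))} {lam : Fin d → ℝ}
    (hu : IsOrderedEigenbasis (covMatrix P X) u lam) (x y : Fin d) :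
    ∫ ω, ⟪u x, X ω⟫ * ⟪u y, X ω⟫ ∂P = if x = y then lam x else 0 := by
  rw [← inner_covMatrix hX hX2, toEuclideanCLM_apply_eigen hu, inner_smul_right, u.inner_eq_ite]
  split_ifs with h
  · rw [h, mul_one]
  · rw [mul_zero]

/-- Pythagoras: `U Uᵀ x` is the orthogonal projection of `x` on the span of the top vectors. -/
lemma norm_sub_topFrame_sq (hk : k < d)
    (v : OrthonormalBasis (Fin d) ℝ (EuclideanSpace ℝ (Fin d))) (x : EuclideanSpace ℝ (Fin d)) :
    ‖x - WithLp.toLp 2 ((topFrame hk v * (topFrame hk v)ᵀ) *ᵥ x.ofLp)‖ ^ 2 =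
      ‖x‖ ^ 2 - ∑ j, ⟪v (topIdx hk j), x⟫ ^ 2 := by
  have h1 : WithLp.toLp 2 ((topFrame hk v * (topFrame hk v)ᵀ) *ᵥ x.ofLp) =
      ∑ j, ⟪v (topIdx hk j), x⟫ • v (topIdx hk j) := by
    ext a
    rw [← mulVec_mulVec]
    simp [mulVec, dotProduct, topFrame, PiLp.inner_apply, mul_comm]
  have hinj : Function.Injective (topIdx (k := k) hk) := fun a b h =>
    Fin.ext (by simpa [topIdx] using h)
  have hon : Orthonormal ℝ fun j => v (topIdx hk j) := v.orthonormal.comp _ hinj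
  rw [h1, norm_sub_sq_real, ← real_inner_self_eq_norm_sq (∑ j, _), hon.inner_sum, inner_sum]
  have h2 : ∀ j : Fin k, ⟪x, v (topIdx hk j)⟫ = ⟪v (topIdx hk j), x⟫ := fun j =>
    real_inner_comm _ _
  simp only [inner_smul_right, h2, conj_trivial, ← sq]
  ring

lemma risk_topFrame (hk : k < d) (hX : AEMeasurable X P)
    (hX2 : Integrable (fun ω => ‖X ω‖ ^ 2) P)
    (v : OrthonormalBasis (Fin d) ℝ (EuclideanSpace ℝ (Fin d))) :
    risk P X (topFrame hk v) = 1 / 2 * (∫ ω, ‖X ω‖ ^ 2 ∂P -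
      ∑ j : Fin k, ∫ ω, ⟪v (topIdx hk j), X ω⟫ * ⟪v (topIdx hk j), X ω⟫ ∂P) := by
  have hint := fun j : Fin k =>
    integrable_inner_mul_inner hX hX2 (v (topIdx hk j)) (v (topIdx hk j))
  rw [risk, ← integral_finsetSum _ fun j _ => hint j,
    ← integral_sub hX2 (integrable_finsetSum _ fun j _ => hint j)]
  simp_rw [norm_sub_topFrame_sq, sq (⟪_, _⟫)]

/-- The excess risk in the eigenbasis of the population covariance. -/
lemma risk_sub_risk (hk : k < d) (hX : AEMeasurable X P)
    (hX2 : Integrable (fun ω => ‖X ω‖ ^ 2) P)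
    {u : OrthonormalBasis (Fin d) ℝ (EuclideanSpace ℝ (Fin d))} {lam : Fin d → ℝ}
    (hu : IsOrderedEigenbasis (covMatrix P X) u lam)
    (v : OrthonormalBasis (Fin d) ℝ (EuclideanSpace ℝ (Fin d))) :
    risk P X (topFrame hk v) - risk P X (topFrame (k := k) hk u) =
      1 / 2 * projExcess (fun a => lam (topIdx hk a)) (fun i : Fin (d - k) => lam (botIdx i))
        (blockProj (overlap hk u v)) := by
  have h1 : ∀ j : Fin k, ∫ ω, ⟪v (topIdx hk j), X ω⟫ * ⟪v (topIdx hk j), X ω⟫ ∂P =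
      ∑ a, lam (topIdx hk a) * ⟪u (topIdx hk a), v (topIdx hk j)⟫ ^ 2 +
      ∑ i : Fin (d - k), lam (botIdx i) * ⟪u (botIdx i), v (topIdx hk j)⟫ ^ 2 := fun j => by
    rw [← inner_covMatrix hX hX2, inner_toEuclideanCLM_eq_sum hu, ← (splitIdx hk).sum_comp,
      Fintype.sum_sum_type]
    simp only [splitIdx_inl, splitIdx_inr]
    congr 1 <;> exact Finset.sum_congr rfl fun _ _ => by rw [real_inner_comm]; ring
  have h2 : ∀ j : Fin k, ∫ ω, ⟪u (topIdx hk j), X ω⟫ * ⟪u (topIdx hk j), X ω⟫ ∂P =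
      lam (topIdx hk j) := fun j => by
    rw [integral_inner_mul_inner_eigen hX hX2 hu, if_pos rfl]
  rw [risk_topFrame hk hX hX2, risk_topFrame hk hX hX2]
  rw [Finset.sum_congr rfl fun j _ => h1 j, Finset.sum_congr rfl fun j _ => h2 j, projExcess,
    ← mul_sub]
  congr 1
  simp only [blockProj_overlap_diag, splitIdx_inl, splitIdx_inr, mul_sub, mul_one, Finset.mul_sum,
    Finset.sum_add_distrib, Finset.sum_sub_distrib]
  rw [Finset.sum_comm (f := fun (j a : Fin k) => lam (topIdx hk a) * _),
    Finset.sum_comm (f := fun (j : Fin k) (i : Fin (d - k)) => lam (botIdx i) * _)]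
  ring

end Risk

/-! ### Law of large numbers in probability -/

section LawOfLargeNumbers

variable {Ω : Type*} [MeasurableSpace Ω] {P : Measure Ω} [IsProbabilityMeasure P]

lemma tendsto_measureReal_abs_mean_sub_gt {x : ℕ → Ω → ℝ} (hint : Integrable (x 0) P)
    (hindep : iIndepFun x P) (hident : ∀ l, IdentDistrib (x l) (x 0) P P) {r : ℝ} (hr : 0 < r) :
    Tendsto (fun n : ℕ => P.real {ω | r < |(n : ℝ)⁻¹ * ∑ l ∈ Finset.range n, x l ω -
      ∫ ω, x 0 ω ∂P|}) atTop (𝓝 0) := by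
  have h1 := strong_law_ae_real x hint (fun i j hij => hindep.indepFun hij) hident
  have hm : ∀ n : ℕ, AEStronglyMeasurable (fun ω => (∑ l ∈ Finset.range n, x l ω) / n) P :=
    fun n => ((Finset.aemeasurable_fun_sum _ fun l _ =>
      (hident l).aemeasurable_fst).div_const _).aestronglyMeasurable
  have h2 := tendstoInMeasure_iff_measureReal_dist.1 (tendstoInMeasure_of_tendsto_ae hm h1) r hr
  refine squeeze_zero (fun _ => measureReal_nonneg) (fun n => measureReal_mono fun ω hω => ?_) h2
  simp only [Set.mem_ofPred_eq, Real.dist_eq] at hω ⊢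
  rw [div_eq_inv_mul]
  exact hω.le

end LawOfLargeNumbers

/-! ### Gaussian fluctuations of the off-diagonal block -/

section Fluctuations

variable {d k : ℕ} (hk : k < d)

/-- The rescaled off-diagonal block of `x xᵀ` in the population eigenbasis. -/
noncomputable def offDiag (u : OrthonormalBasis (Fin d) ℝ (EuclideanSpace ℝ (Fin d)))
    (lam : Fin d → ℝ) (x : EuclideanSpace ℝ (Fin d)) : EuclideanSpace ℝ (Fin (d - k) × Fin k) :=
  WithLp.toLp 2 fun a => ⟪u (botIdx a.1), x⟫ * ⟪u (topIdx hk a.2), x⟫ / √(gap hk lam a.1 a.2)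

variable {u : OrthonormalBasis (Fin d) ℝ (EuclideanSpace ℝ (Fin d))} {lam : Fin d → ℝ}

lemma measurable_offDiag : Measurable (offDiag (k := k) hk u lam) := by
  unfold offDiag
  fun_prop

lemma inner_offDiag (t : EuclideanSpace ℝ (Fin (d - k) × Fin k)) (x : EuclideanSpace ℝ (Fin d)) :
    ⟪t, offDiag hk u lam x⟫ = ∑ a, t a / √(gap hk lam a.1 a.2) *
      (⟪u (botIdx a.1), x⟫ * ⟪u (topIdx hk a.2), x⟫) := by
  simp only [PiLp.inner_apply, offDiag]
  refine Finset.sum_congr rfl fun a _ => ?_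
  simp
  ring

variable {Ω : Type*} [MeasurableSpace Ω] {P : Measure Ω} {X : Ω → EuclideanSpace ℝ (Fin d)}

lemma botIdx_ne_topIdx (i : Fin (d - k)) (j : Fin k) : botIdx i ≠ topIdx hk j := fun h => by
  have := j.isLt
  simp only [botIdx, topIdx, Fin.mk.injEq] at h
  omega

/-- Distinct vectors of the eigenbasis of `Σ` give coordinates of `X` whose product has mean zero,
so no centring of `X` is needed. -/
lemma integral_inner_offDiag (hX : AEMeasurable X P) (hX2 : Integrable (fun ω => ‖X ω‖ ^ 2) P)
    (hu : IsOrderedEigenbasis (covMatrix P X) u lam)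
    (t : EuclideanSpace ℝ (Fin (d - k) × Fin k)) :
    ∫ ω, ⟪t, offDiag hk u lam (X ω)⟫ ∂P = 0 := by
  simp_rw [inner_offDiag]
  rw [integral_finsetSum _ fun a _ => (integrable_inner_mul_inner hX hX2 _ _).const_mul _]
  refine Finset.sum_eq_zero fun a _ => ?_
  rw [integral_const_mul, integral_inner_mul_inner_eigen hX hX2 hu,
    if_neg (botIdx_ne_topIdx hk _ _), mul_zero]

/-- Square integrability of each entry is the finiteness of `Λ_{ijij}`. -/
lemma memLp_inner_offDiag (hX : AEMeasurable X P)
    (hmom : ∀ (i s : Fin (d - k)) (j t : Fin k), Integrable (fun ω =>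
      ⟪u (botIdx i), X ω⟫ * ⟪u (topIdx hk j), X ω⟫ *
        ⟪u (botIdx s), X ω⟫ * ⟪u (topIdx hk t), X ω⟫) P)
    (t : EuclideanSpace ℝ (Fin (d - k) × Fin k)) :
    MemLp (fun ω => ⟪t, offDiag hk u lam (X ω)⟫) 2 P := by
  simp_rw [inner_offDiag]
  refine memLp_finsetSum _ fun a _ => MemLp.const_mul ?_ _
  rw [memLp_two_iff_integrable_sq (by fun_prop)]
  refine (hmom a.1 a.1 a.2 a.2).congr (.of_forall fun ω => ?_)
  simp only
  ring

lemma integral_inner_offDiag_sq (hgap : ∀ i j, 0 < gap (k := k) hk lam i j)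
    (hmom : ∀ (i s : Fin (d - k)) (j t : Fin k), Integrable (fun ω =>
      ⟪u (botIdx i), X ω⟫ * ⟪u (topIdx hk j), X ω⟫ *
        ⟪u (botIdx s), X ω⟫ * ⟪u (topIdx hk t), X ω⟫) P)
    (t : EuclideanSpace ℝ (Fin (d - k) × Fin k)) :
    ∫ ω, ⟪t, offDiag hk u lam (X ω)⟫ ^ 2 ∂P = t ⬝ᵥ covH hk P X u lam *ᵥ t := by
  have hsq : ∀ ω, ⟪t, offDiag hk u lam (X ω)⟫ ^ 2 = ∑ a, ∑ b, (t a * t b /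
      √(gap hk lam a.1 a.2 * gap hk lam b.1 b.2)) *
      (⟪u (botIdx a.1), X ω⟫ * ⟪u (topIdx hk a.2), X ω⟫ *
        ⟪u (botIdx b.1), X ω⟫ * ⟪u (topIdx hk b.2), X ω⟫) := fun ω => by
    rw [inner_offDiag, sq, Finset.sum_mul_sum]
    refine Finset.sum_congr rfl fun a _ => Finset.sum_congr rfl fun b _ => ?_
    rw [Real.sqrt_mul (hgap _ _).le]
    ring
  simp_rw [hsq]
  rw [integral_finsetSum _ fun a _ => integrable_finsetSum _ fun b _ => (hmom _ _ _ _).const_mul _,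
    dotProduct]
  refine Finset.sum_congr rfl fun a _ => ?_
  rw [integral_finsetSum _ fun b _ => (hmom _ _ _ _).const_mul _, mulVec, dotProduct,
    Finset.mul_sum]
  refine Finset.sum_congr rfl fun b _ => ?_
  rw [integral_const_mul]
  simp only [covH, fourthMoment, Matrix.of_apply]
  ring

/-- Identifies the first term of `B(δ)` with `E‖H‖²`, the form in which the Gaussian bounds are
stated. -/
lemma trace_covH (hgap : ∀ i j, 0 < gap (k := k) hk lam i j) :
    (covH (k := k) hk P X u lam).trace = traceTerm (k := k) hk P X u lam := by
  rw [Matrix.trace, traceTerm, Fintype.sum_prod_type]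
  refine Finset.sum_congr rfl fun i _ => Finset.sum_congr rfl fun j _ => ?_
  rw [Matrix.diag_apply, covH, Matrix.of_apply, Real.sqrt_mul_self (hgap i j).le, fourthMoment, gap]
  congr 1
  refine integral_congr_ae (.of_forall fun ω => ?_)
  simp only
  ring

/-- The leading term of the excess risk is the squared norm of a normalized sum of i.i.d.
vectors. -/
lemma mul_leading_eq_norm_sq (hgap : ∀ i j, 0 < gap (k := k) hk lam i j)
    (x : ℕ → EuclideanSpace ℝ (Fin d)) (n : ℕ) :
    n * ∑ i, ∑ a, ⟪u (botIdx i), toEuclideanCLM (𝕜 := ℝ) (empCovMatrix x n)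
      (u (topIdx hk a))⟫ ^ 2 / gap hk lam i a =
      ‖(√n)⁻¹ • ∑ l ∈ Finset.range n, offDiag (k := k) hk u lam (x l)‖ ^ 2 := by
  rw [EuclideanSpace.real_norm_sq_eq, Fintype.sum_prod_type, Finset.mul_sum]
  refine Finset.sum_congr rfl fun i _ => ?_
  rw [Finset.mul_sum]
  refine Finset.sum_congr rfl fun a _ => ?_
  rw [inner_empCovMatrix]
  simp only [offDiag, PiLp.smul_apply, WithLp.ofLp_sum, Finset.sum_apply, smul_eq_mul,
    ← Finset.sum_div]
  rw [mul_pow, mul_pow, div_pow, Real.sq_sqrt (hgap i a).le, inv_pow, inv_pow,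
    Real.sq_sqrt (Nat.cast_nonneg n)]
  rcases eq_or_ne n 0 with rfl | hn
  · simp
  · have : (n : ℝ) ≠ 0 := Nat.cast_ne_zero.2 hn
    field_simp

end Fluctuations

/-- The rescaled quantiles of the excess risk converge to the quantile of `‖H‖² / 2`. -/
theorem tendsto_mul_quantile_excess_risk
    {d k : ℕ} (hk1 : 1 ≤ k) (hk : k < d)
    {Ω : Type*} [MeasurableSpace Ω] (P : Measure Ω) [IsProbabilityMeasure P]
    {Ω' : Type*} [MeasurableSpace Ω'] (P' : Measure Ω') [IsProbabilityMeasure P']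
    (Xs : ℕ → Ω → EuclideanSpace ℝ (Fin d)) (X : Ω' → EuclideanSpace ℝ (Fin d))
    (hindep : iIndepFun Xs P) (hident : ∀ i, IdentDistrib (Xs i) X P P')
    (hX2 : Integrable (fun ω => ‖X ω‖ ^ 2) P')
    (u : OrthonormalBasis (Fin d) ℝ (EuclideanSpace ℝ (Fin d))) (lam : Fin d → ℝ)
    (hu : IsOrderedEigenbasis (covMatrix P' X) u lam)
    (hgap : lam ⟨k, hk⟩ < lam ⟨k - 1, (Nat.sub_le k 1).trans_lt hk⟩)
    (hgap' : ∀ i j, 0 < gap (k := k) hk lam i j)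
    (hmom : ∀ (i s : Fin (d - k)) (j t : Fin k), Integrable (fun ω =>
      ⟪u (botIdx i), X ω⟫ * ⟪u (topIdx hk j), X ω⟫ *
        ⟪u (botIdx s), X ω⟫ * ⟪u (topIdx hk t), X ω⟫) P')
    (un : ℕ → Ω → OrthonormalBasis (Fin d) ℝ (EuclideanSpace ℝ (Fin d)))
    (lamn : ℕ → Ω → Fin d → ℝ)
    (hun : ∀ n ω, IsOrderedEigenbasis (empCovMatrix (fun i => Xs i ω) n)
      (un n ω) (lamn n ω))
    {p : ℝ} (hp0 : 0 < p) (hp1 : p ≤ 1)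
    (hpτ : p = 1 → 0 < tauSq (k := k) hk P' X u lam) :
    Tendsto (fun n : ℕ => ((n : ℝ) : EReal) * quantile P
        (fun ω => risk P' X (topFrame (k := k) hk (un n ω)) -
          risk P' X (topFrame (k := k) hk u)) p) atTop
      (𝓝 (quantile (lawH (k := k) hk P' X u lam) (fun h => ‖h‖ ^ 2 / 2) p)) := by
  have : Nonempty (Fin (d - k) × Fin k) := ⟨(⟨0, by omega⟩, ⟨0, by omega⟩)⟩
  have hX : AEMeasurable X P' := (hident 0).aemeasurable_snd
  have hS := covH_posSemidef hk P' X u lam hgap' hmom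
  have hid0 : ∀ l, IdentDistrib (Xs l) (Xs 0) P P := fun l => (hident l).trans (hident 0).symm
  have hΦ := measurable_offDiag (k := k) hk (u := u) (lam := lam)
  have hin : ∀ t, Measurable fun x => ⟪t, offDiag (k := k) hk u lam x⟫ := fun t => by fun_prop
  have hclt := tendstoInDistribution_inv_sqrt_smul_sum hS
    (ξ := fun l ω => offDiag (k := k) hk u lam (Xs l ω))
    (hindep.comp (fun _ => offDiag (k := k) hk u lam) fun _ => hΦ)
    (fun l => (hid0 l).comp hΦ)
    (fun t => ((hident 0).comp (hin t)).memLp_iff.2 (memLp_inner_offDiag hk hX hmom t))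
    (fun t => ((hident 0).comp (hin t)).integral_eq.trans
      (integral_inner_offDiag hk hX hX2 hu t))
    (fun t => ((hident 0).comp ((hin t).pow_const 2)).integral_eq.trans
      (integral_inner_offDiag_sq hk hgap' hmom t))
  refine tendsto_mul_quantile_of_relative_error hclt (V := fun h => ‖h‖ ^ 2 / 2) (by fun_prop)
    (fun h => by positivity) (fun η hη => ?_) hp0.le
    (fun a b hab ha => lt_measureReal_of_le_measureReal hS hp0 hp1 hpτ hab ha)
  obtain ⟨r, hr, H⟩ := exists_relative_error_le hk (u := u) hk1 hu.1 hgap hη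
  have hlln : ∀ x y : Fin d, Tendsto (fun n : ℕ => P.real {ω | r <
      |⟪u x, toEuclideanCLM (𝕜 := ℝ) (empCovMatrix (fun i => Xs i ω) n) (u y)⟫ -
        if x = y then lam x else 0|}) atTop (𝓝 0) := fun x y => by
    have hxy : Measurable fun z : EuclideanSpace ℝ (Fin d) => ⟪u x, z⟫ * ⟪u y, z⟫ := by fun_prop
    have h := tendsto_measureReal_abs_mean_sub_gt (P := P)
      (x := fun l ω => ⟪u x, Xs l ω⟫ * ⟪u y, Xs l ω⟫)
      (((hident 0).comp hxy).integrable_iff.2 (integrable_inner_mul_inner hX hX2 _ _))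
      (hindep.comp (fun _ z => ⟪u x, z⟫ * ⟪u y, z⟫) fun _ => hxy)
      (fun l => (hid0 l).comp hxy) hr
    have e : ∫ ω, ⟪u x, Xs 0 ω⟫ * ⟪u y, Xs 0 ω⟫ ∂P = if x = y then lam x else 0 :=
      ((hident 0).comp hxy).integral_eq.trans (integral_inner_mul_inner_eigen hX hX2 hu x y)
    simp only [e] at h
    simpa only [inner_empCovMatrix] using h
  have hsum : Tendsto (fun n : ℕ => ∑ x, ∑ y, P.real {ω | r <
      |⟪u x, toEuclideanCLM (𝕜 := ℝ) (empCovMatrix (fun i => Xs i ω) n) (u y)⟫ -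
        if x = y then lam x else 0|}) atTop (𝓝 0) := by
    have := tendsto_finsetSum Finset.univ fun x _ => tendsto_finsetSum Finset.univ fun y _ =>
      hlln x y
    simpa using this
  refine squeeze_zero (fun _ => measureReal_nonneg) (fun n => ?_) hsum
  -- When all `d²` entries of `Σₙ` are within `r` of those of `Σ`, the deterministic bound holds for
  -- any choice of eigenbasis, so the relative error can fail only on the union of the entrywise
  -- deviation events.
  have hsub : {ω | ¬ |n * (risk P' X (topFrame (k := k) hk (un n ω)) -
      risk P' X (topFrame (k := k) hk u)) -
        ‖(√n)⁻¹ • ∑ l ∈ Finset.range n, offDiag (k := k) hk u lam (Xs l ω)‖ ^ 2 / 2| ≤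
      η * (‖(√n)⁻¹ • ∑ l ∈ Finset.range n, offDiag (k := k) hk u lam (Xs l ω)‖ ^ 2 / 2)} ⊆
      ⋃ x, ⋃ y, {ω | r <
      |⟪u x, toEuclideanCLM (𝕜 := ℝ) (empCovMatrix (fun i => Xs i ω) n) (u y)⟫ -
        if x = y then lam x else 0|} := fun ω hω => by
    by_contra hcon
    simp only [Set.mem_iUnion, Set.mem_ofPred_eq, not_exists, not_lt] at hcon hω
    refine hω ?_
    -- The factor `n / 2` combines the rescaling by `n` with the `1/2` in the risk.
    have key := mul_le_mul_of_nonneg_left (H _ _ _ (hun n ω) hcon)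
      (by positivity : (0 : ℝ) ≤ n / 2)
    rw [risk_sub_risk hk hX hX2 hu, ← mul_leading_eq_norm_sq hk hgap' (fun l => Xs l ω) n]
    rw [← abs_of_nonneg (by positivity : (0 : ℝ) ≤ n / 2), ← abs_mul,
      abs_of_nonneg (by positivity : (0 : ℝ) ≤ n / 2)] at key
    refine le_trans (le_of_eq ?_) (key.trans (le_of_eq ?_))
    · congr 1
      ring
    · ring
  refine (measureReal_mono hsub).trans ((measureReal_iUnion_fintype_le _).trans ?_)
  exact Finset.sum_le_sum fun x _ => measureReal_iUnion_fintype_le _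

end PCA

theorem corollary1
    {d k : ℕ} (hk1 : 1 ≤ k) (hk : k < d)
    -- the i.i.d. data points, and a random vector `X` with their common distribution
    {Ω : Type*} [MeasurableSpace Ω] (P : Measure Ω) [IsProbabilityMeasure P]
    {Ω' : Type*} [MeasurableSpace Ω'] (P' : Measure Ω') [IsProbabilityMeasure P']
    (Xs : ℕ → Ω → EuclideanSpace ℝ (Fin d)) (X : Ω' → EuclideanSpace ℝ (Fin d))
    (hindep : iIndepFun Xs P) (hident : ∀ i, IdentDistrib (Xs i) X P P')
    -- `E‖X‖² < ∞`
    (hX2 : Integrable (fun ω => ‖X ω‖ ^ 2) P')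
    -- ordered eigenbasis of the population covariance matrix
    (u : OrthonormalBasis (Fin d) ℝ (EuclideanSpace ℝ (Fin d))) (lam : Fin d → ℝ)
    (hu : PCA.IsOrderedEigenbasis (PCA.covMatrix P' X) u lam)
    -- the eigengap `λ_{k+1} < λ_k` (indices start at 0 here)
    (hgap : lam ⟨k, hk⟩ < lam ⟨k - 1, (Nat.sub_le k 1).trans_lt hk⟩)
    -- all the moments `Λ_{ijst}` are finite
    (hmom : ∀ (i s : Fin (d - k)) (j t : Fin k), Integrable (fun ω =>
      ⟪u (PCA.botIdx i), X ω⟫ * ⟪u (PCA.topIdx hk j), X ω⟫ *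
        ⟪u (PCA.botIdx s), X ω⟫ * ⟪u (PCA.topIdx hk t), X ω⟫) P')
    -- ordered eigenbases of the empirical covariance matrices
    (un : ℕ → Ω → OrthonormalBasis (Fin d) ℝ (EuclideanSpace ℝ (Fin d)))
    (lamn : ℕ → Ω → Fin d → ℝ)
    (hun : ∀ n ω, PCA.IsOrderedEigenbasis (PCA.empCovMatrix (fun i => Xs i ω) n)
      (un n ω) (lamn n ω))
    (δ : ℝ) (hδ0 : 0 ≤ δ) (hδ1 : δ < 1 / 10)
    -- the right-hand side is not of the form `0 · ∞`
    (hδτ : δ = 0 → 0 < PCA.tauSq (k := k) hk P' X u lam) :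
    ∃ L : EReal,
      Tendsto (fun n : ℕ => ((n : ℝ) : EReal) * PCA.quantile P
        (fun ω => PCA.risk P' X (PCA.topFrame (k := k) hk (un n ω)) -
          PCA.risk P' X (PCA.topFrame (k := k) hk u)) (1 - δ)) atTop (𝓝 L) ∧
      ((1 / 64 : ℝ) : EReal) *
        ((PCA.traceTerm (k := k) hk P' X u lam : EReal) +
          ((2 * PCA.tauSq (k := k) hk P' X u lam : ℝ) : EReal) * PCA.logInv δ) ≤ L ∧
      L ≤ (PCA.traceTerm (k := k) hk P' X u lam : EReal) +
          ((2 * PCA.tauSq (k := k) hk P' X u lam : ℝ) : EReal) * PCA.logInv δ := by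
  have hgap' : ∀ i j, 0 < PCA.gap (k := k) hk lam i j := fun i j => by
    have h1 : lam (PCA.botIdx i) ≤ lam ⟨k, hk⟩ := hu.1 (by simp [PCA.botIdx])
    have h2 : lam ⟨k - 1, (Nat.sub_le k 1).trans_lt hk⟩ ≤ lam (PCA.topIdx hk j) := hu.1 (by
      have := j.isLt
      simp only [PCA.topIdx, Fin.mk_le_mk]
      omega)
    rw [PCA.gap]
    linarith
  have : Nonempty (Fin (d - k) × Fin k) := ⟨(⟨0, by omega⟩, ⟨0, by omega⟩)⟩
  have hS := PCA.covH_posSemidef hk P' X u lam hgap' hmom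
  refine ⟨_, PCA.tendsto_mul_quantile_excess_risk hk1 hk P P' Xs X hindep hident hX2 u lam hu hgap
    hgap' hmom un lamn hun (by linarith) (by linarith) (fun h => hδτ (by linarith)), ?_⟩
  rw [← PCA.trace_covH hk hgap']
  rcases hδ0.eq_or_lt with rfl | hδ
  · have hτ := hδτ rfl
    have hq : PCA.quantile (PCA.lawH (k := k) hk P' X u lam) (fun h => ‖h‖ ^ 2 / 2) (1 - 0) = ⊤ := by
      rw [PCA.quantile, sInf_eq_top]
      rintro _ ⟨t, ht, rfl⟩
      have := PCA.measureReal_sq_norm_le_lt_one hS hτ t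
      rw [sub_zero] at ht
      exact absurd ht (not_le.2 this)
    have hlog : PCA.logInv 0 = ⊤ := by simp [PCA.logInv]
    rw [hq, hlog, EReal.coe_mul_top_of_pos (by linarith), EReal.coe_add_top]
    exact ⟨le_top, le_rfl⟩
  · have hlog : PCA.logInv δ = (Real.log (1 / δ) : ℝ) := by
      rw [PCA.logInv, ENNReal.log_inv, ENNReal.log_ofReal_of_pos hδ, one_div, Real.log_inv,
        EReal.coe_neg]
    rw [hlog, ← EReal.coe_mul, ← EReal.coe_add, ← EReal.coe_mul]
    refine ⟨le_sInf ?_, PCA.quantile_le_of_le ?_⟩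
    · rintro _ ⟨t, ht, rfl⟩
      exact EReal.coe_le_coe_iff.2
        (PCA.le_of_one_sub_le_measureReal_sq_norm_le hS hδ hδ1 ht)
    · exact PCA.one_sub_le_measureReal_sq_norm_le hS hδ
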